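/- Let $N\ge 1$ and let $I_1,\dots,I_N$ be positive integers with $I:=\max_n I_n$ and $\min_n I_n\ge (N-1)\log_2^2(I)+1$. Let $0<\beta\le\alpha$ and $R\in\mathbb N$. The nonnegative rank $\operatorname{rank}_+(\mathcal T)$ of an entrywise nonnegative tensor $\mathcal T\in\mathbb R^{I_1\times\cdots\times I_N}$ is the least number of terms in a decomposition of $\mathcal T$ into a sum of outer products of $N$ entrywise nonnegative vectors. Put $$S_R^+(\beta,\alpha)=\{\mathcal T\in\mathbb R^{I_1\times\cdots\times I_N} : \beta\le t_{\mathbf i}\le\alpha\ \text{for all } \mathbf i,\ \operatorname{rank}_+(\mathcal T)\le R\}.$$ For a set $S$ of multi-indices and nonnegative integer counts $\mathcal X=(x_{\mathbf i})$ let $$f_S(\mathcal T,\mathcal X)=\sum_{\mathbf i\in S}\bigl(x_{\mathbf i}\log t_{\mathbf i}-t_{\mathbf i}-\log(x_{\mathbf i}!)\bigr),\qquad \tilde f_S(\mathcal T,\mathcal X)=\sum_{\mathbf i\in S}\bigl(x_{\mathbf i}\log t_{\mathbf i}-\log(e^{t_{\mathbf i}}-1)-\log(x_{\mathbf i}!)\bigr).$$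 Let $\mathcal M\in S_R^+(\beta,\alpha)$, let $\Omega$ be uniformly distributed on the sets of multi-indices of a fixed cardinality $|\Omega|\ge 1$, and suppose that, given $\Omega$, the counts $x_{\mathbf i}$, $\mathbf i\in\Omega$, are independent with $x_{\mathbf i}\sim\mathrm{Poisson}(m_{\mathbf i})$ (nothing is assumed on the entries outside $\Omega$). Let $\Gamma=\{\mathbf i\in\Omega : x_{\mathbf i}\ne 0\}$. Then there is a constant $C_N>0$ depending only on $N$ such that, with $$\varepsilon := C_N\,\frac{\alpha(\alpha+1)^2}{\beta^3}\,\frac{R\,I^{1/2}\log_2(I)}{|\Omega|^{1/2}},\qquad \kappa:=\frac{(4+\beta)e^{\beta}-4}{2(e^{\beta}-\beta-1)},$$ each of the following two statements holds with probability at least $1-|\Omega|^{-1}$ over $(\Omega,\mathcal X)$ (here $\|\cdot\|$ is the Frobenius norm): 1. every $\widehat{\mathcal M}\in S_R^+(\beta,\alpha)$ with $f_\Omega(\widehat{\mathcal M},\mathcal X)\ge f_\Omega(\mathcal M,\mathcal X)$ satisfies $\|\mathcal M-\widehat{\mathcal M}\|^2/\|\mathcal M\|^2\le\varepsilon$; 2.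 every $\widetilde{\mathcal M}\in S_R^+(\beta,\alpha)$ with $\tilde f_\Gamma(\widetilde{\mathcal M},\mathcal X)\ge\tilde f_\Gamma(\mathcal M,\mathcal X)$ satisfies $\|\mathcal M-\widetilde{\mathcal M}\|^2/\|\mathcal M\|^2\le\kappa\,\varepsilon$. In particular, for fixed $N,\alpha,\beta$, $\varepsilon=O(R\,I^{1/2}\log_2(I)\,|\Omega|^{-1/2})$. -/

import Mathlib

open MeasureTheory ProbabilityTheory

namespace ZTPoisson

/-- Multi-indices of an `N`-way array with dimensions `d 0, …, d (N - 1)`. -/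
abbrev MultiIndex {N : ℕ} (d : Fin N → ℕ) : Type := ∀ n : Fin N, Fin (d n)

/-- Real `N`-way tensors with dimensions `d`. -/
abbrev Tensor {N : ℕ} (d : Fin N → ℕ) : Type := MultiIndex d → ℝ

/-- `T` is a sum of `R` outer products of entrywise nonnegative vectors. -/
def HasNNCP {N : ℕ} {d : Fin N → ℕ} (T : Tensor d) (R : ℕ) : Prop :=
  ∃ a : Fin R → ∀ n : Fin N, Fin (d n) → ℝ,
    (∀ r n j, 0 ≤ a r n j) ∧ ∀ i, T i = ∑ r, ∏ n, a r n (i n)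

/-- The nonnegative canonical polyadic rank (`⊤` if there is no such decomposition,
which happens only for tensors with a negative entry). -/
noncomputable def nnRank {N : ℕ} {d : Fin N → ℕ} (T : Tensor d) : ℕ∞ :=
  ⨅ (R : ℕ) (_ : HasNNCP T R), (R : ℕ∞)

/-- The search space: entries in `[β, α]` and nonnegative rank at most `R`. -/
def searchSpace {N : ℕ} (d : Fin N → ℕ) (R : ℕ) (β α : ℝ) : Set (Tensor d) :=
  {T | (∀ i, β ≤ T i ∧ T i ≤ α) ∧ nnRank T ≤ R}

/-- The squared Euclidean (Frobenius) norm of a tensor. -/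
def sqNorm {N : ℕ} {d : Fin N → ℕ} (T : Tensor d) : ℝ := ∑ i, T i ^ 2

/-- The Poisson log-likelihood over the index set `S`. -/
noncomputable def logLik {N : ℕ} {d : Fin N → ℕ} (S : Finset (MultiIndex d))
    (M : Tensor d) (x : MultiIndex d → ℕ) : ℝ :=
  ∑ i ∈ S, ((x i : ℝ) * Real.log (M i) - M i - Real.log ((x i).factorial : ℝ))

/-- The zero-truncated Poisson log-likelihood over the index set `S`. -/
noncomputable def ztLogLik {N : ℕ} {d : Fin N → ℕ} (S : Finset (MultiIndex d))
    (M : Tensor d) (x : MultiIndex d → ℕ) : ℝ :=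
  ∑ i ∈ S, ((x i : ℝ) * Real.log (M i) - Real.log (Real.exp (M i) - 1)
    - Real.log ((x i).factorial : ℝ))

/-- The indices in `S` at which the count is nonzero. -/
def nonzeros {N : ℕ} {d : Fin N → ℕ} (S : Finset (MultiIndex d))
    (x : MultiIndex d → ℕ) : Finset (MultiIndex d) :=
  S.filter (fun i => x i ≠ 0)

/-- The sampling model: `Ω` is uniform among the index sets of cardinality `p` and, given `Ω`,
the counts at the indices in `Ω` are independent, the one at `i` being Poisson with mean `M i`.
Nothing is assumed on the counts outside `Ω`. -/
structure IsPoissonSample {N : ℕ} {d : Fin N → ℕ} {W : Type*} [MeasurableSpace W]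
    (μ : Measure W) (M : Tensor d) (p : ℕ)
    (Ω : W → Finset (MultiIndex d)) (X : W → MultiIndex d → ℕ) : Prop where
  measurableSet_eq : ∀ S, MeasurableSet {w | Ω w = S}
  measurable_count : ∀ i, Measurable (fun w => X w i)
  card_eq : ∀ᵐ w ∂μ, (Ω w).card = p
  uniform : ∀ S : Finset (MultiIndex d), S.card = p →
    μ {w | Ω w = S} = ((Nat.choose (Fintype.card (MultiIndex d)) p : ℕ) : ENNReal)⁻¹
  indep : ∀ S : Finset (MultiIndex d), S.card = p →
    iIndepFun (fun (i : S) (w : W) => X w i) (μ[|{w | Ω w = S}])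
  poisson : ∀ S : Finset (MultiIndex d), S.card = p → ∀ i ∈ S,
    (μ[|{w | Ω w = S}]).map (fun w => X w i) = poissonMeasure (M i).toNNReal

/-- The relative squared error of `T` as an estimate of `M`. -/
noncomputable def relErr {N : ℕ} {d : Fin N → ℕ} (M T : Tensor d) : ℝ :=
  sqNorm (M - T) / sqNorm M

/-- The largest dimension. -/
def maxDim {N : ℕ} (d : Fin N → ℕ) : ℕ := Finset.univ.sup d

/-- The error amplification factor of the zero-truncated estimator. -/
noncomputable def kappa (β : ℝ) : ℝ :=
  ((4 + β) * Real.exp β - 4) / (2 * (Real.exp β - β - 1))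

/-- The error level
`ε = C * (α * (α + 1) ^ 2 / β ^ 3) * R * I ^ (1 / 2) * log₂ I * p ^ (-1 / 2)`. -/
noncomputable def errLevel (C α β : ℝ) (R I p : ℕ) : ℝ :=
  C * (α * (α + 1) ^ 2 / β ^ 3) * ((R : ℝ) * Real.sqrt I * Real.logb 2 I / Real.sqrt p)

end ZTPoisson

/-! The proof is a union bound on fractional moments of likelihood ratios. For a fixed candidate
`Q`, raise the ratio of `Q` to `M` to the power s = 1/(2(1+α)). Given `Ω`, its expectation
factorises over the observed entries, and each factor is at most 1 - γ(m - q)²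
(`lintegral_exp_poissonTerm_le`, `lintegral_exp_ztTerm_le`). Averaging the product over `Ω` is
sampling without replacement; Maclaurin's inequality (`sum_powersetCard_prod_le`) shows that this is
no worse than independent draws, giving exp(-pγ · mean squared distance).

The search space is discretised by rounding rank-one factors to a grid (`exists_gridTensor_ge`).
Rounding goes upward: the term x log t then only increases, so the loss in the criterion does not
involve the unbounded counts. Markov's inequality for the sum of ratios, each weighted by the
inverse of its bound (`measure_le_ratioSum_le`), controls all grid points simultaneously. Hence the
relative error is, up to constants, log(p · grid size)/p plus rounding
(`one_sub_inv_le_measureReal_relErr_le`), which is at most a constant times the square of `rate`.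

If `rate` is at least 1, the trivial bound α²/β² on the error suffices. Otherwise its square is
below itself, which settles the Poisson case; in the truncated case the geometric mean of the fast
bound and the trivial one has the right dependence on β. -/

namespace ZTPoisson

/-! ### Maclaurin's inequality for elementary symmetric sums. -/

section Maclaurin

open Finset

variable {ι : Type*} [Fintype ι] [DecidableEq ι]

lemma sum_powersetCard_succ_sum_erase (k : ℕ) (g : Finset ι → ι → ℝ) :
    ∑ S ∈ powersetCard (k + 1) univ, ∑ i ∈ S, g (S.erase i) i
      = ∑ K ∈ powersetCard k univ, ∑ i ∈ Kᶜ, g K i := by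
  rw [Finset.sum_sigma', Finset.sum_sigma']
  refine Finset.sum_bij' (fun a _ => ⟨a.1.erase a.2, a.2⟩) (fun a _ => ⟨insert a.2 a.1, a.2⟩)
    ?_ ?_ ?_ ?_ ?_
  · rintro ⟨S, i⟩ h
    simp only [mem_sigma, mem_powersetCard, subset_univ, true_and, mem_compl] at h ⊢
    refine ⟨?_, by simp⟩
    rw [card_erase_of_mem h.2, h.1]
    rfl
  · rintro ⟨K, i⟩ h
    simp only [mem_sigma, mem_powersetCard, subset_univ, true_and, mem_compl] at h ⊢
    refine ⟨?_, by simp⟩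
    rw [card_insert_of_notMem h.2, h.1]
  · rintro ⟨S, i⟩ h
    simp only [mem_sigma] at h
    simp [insert_erase h.2]
  · rintro ⟨K, i⟩ h
    simp only [mem_sigma, mem_compl] at h
    simp [erase_insert h.2]
  · rintro ⟨S, i⟩ h
    rfl

lemma succ_mul_sum_powersetCard_succ (k : ℕ) (y : ι → ℝ) :
    ((k : ℝ) + 1) * ∑ S ∈ powersetCard (k + 1) univ, ∏ i ∈ S, y i
      = ∑ K ∈ powersetCard k univ, ∑ i ∈ Kᶜ, (∏ j ∈ K, y j) * y i := by
  rw [← sum_powersetCard_succ_sum_erase k (fun K i => (∏ j ∈ K, y j) * y i), Finset.mul_sum]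
  refine Finset.sum_congr rfl fun S hS => ?_
  rw [Finset.sum_congr rfl fun i hi => Finset.prod_erase_mul S y hi]
  simp [(mem_powersetCard.1 hS).2]

/-- One step of Maclaurin's chain. Expanding e₁ · e_p gives (p+1)e_{p+1} plus terms with a repeated
index; grouping both parts by a common (p-1)-subset `K` leaves off-diagonal products against squares
over the complement of `K`. -/
lemma card_mul_sum_powersetCard_succ_le (p : ℕ) {y : ι → ℝ} (hy : ∀ i, 0 ≤ y i) :
    (Fintype.card ι : ℝ) * (((p : ℝ) + 1) * ∑ S ∈ powersetCard (p + 1) univ, ∏ i ∈ S, y i)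
      ≤ ((Fintype.card ι : ℝ) - p) * ((∑ i, y i) * ∑ S ∈ powersetCard p univ, ∏ i ∈ S, y i) := by
  rcases p with _ | k
  · rw [succ_mul_sum_powersetCard_succ]
    simp
  set E := ((((k + 1 : ℕ) : ℝ) + 1) * ∑ S ∈ powersetCard (k + 1 + 1) univ, ∏ i ∈ S, y i) with hE
  have hE1 : E = ∑ S ∈ powersetCard (k + 1) univ, (∏ j ∈ S, y j) * ∑ i ∈ Sᶜ, y i := by
    rw [hE, succ_mul_sum_powersetCard_succ]
    simp_rw [Finset.mul_sum]
  set A := ∑ S ∈ powersetCard (k + 1) univ, (∏ j ∈ S, y j) * ∑ i ∈ S, y i with hA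
  have hsplit : (∑ i, y i) * ∑ S ∈ powersetCard (k + 1) univ, ∏ i ∈ S, y i = E + A := by
    rw [hE1, hA, ← Finset.sum_add_distrib, Finset.mul_sum]
    refine Finset.sum_congr rfl fun S _ => ?_
    rw [← Finset.sum_compl_add_sum S y]
    ring
  have hA2 : A = ∑ K ∈ powersetCard k univ, (∏ j ∈ K, y j) * ∑ i ∈ Kᶜ, y i ^ 2 := by
    have h := sum_powersetCard_succ_sum_erase k (fun K i => (∏ j ∈ K, y j) * y i ^ 2)
    simp_rw [Finset.mul_sum]
    rw [← h, hA]
    refine Finset.sum_congr rfl fun S _ => ?_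
    rw [Finset.mul_sum]
    refine Finset.sum_congr rfl fun i hi => ?_
    rw [← Finset.prod_erase_mul S y hi]
    ring
  have hE2 : ((k : ℝ) + 1) * E = ∑ K ∈ powersetCard k univ,
      (∏ j ∈ K, y j) * ((∑ i ∈ Kᶜ, y i) ^ 2 - ∑ i ∈ Kᶜ, y i ^ 2) := by
    have h := sum_powersetCard_succ_sum_erase k
      (fun K i => (∏ j ∈ K, y j) * y i * ((∑ j ∈ Kᶜ, y j) - y i))
    have h1 : ∀ K : Finset ι, (∏ j ∈ K, y j) * ((∑ i ∈ Kᶜ, y i) ^ 2 - ∑ i ∈ Kᶜ, y i ^ 2)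
        = ∑ i ∈ Kᶜ, (∏ j ∈ K, y j) * y i * ((∑ j ∈ Kᶜ, y j) - y i) := by
      intro K
      have : ∀ i ∈ Kᶜ, (∏ j ∈ K, y j) * y i * ((∑ j ∈ Kᶜ, y j) - y i)
          = (∏ j ∈ K, y j) * (y i * (∑ j ∈ Kᶜ, y j) - y i ^ 2) := fun i _ => by ring
      rw [Finset.sum_congr rfl this, ← Finset.mul_sum, Finset.sum_sub_distrib, ← Finset.sum_mul]
      ring
    rw [Finset.sum_congr rfl fun K _ => h1 K, ← h, hE1, Finset.mul_sum]
    refine Finset.sum_congr rfl fun S hS => ?_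
    have h2 : ∀ i ∈ S, (∏ j ∈ S.erase i, y j) * y i * ((∑ j ∈ (S.erase i)ᶜ, y j) - y i)
        = (∏ j ∈ S, y j) * ∑ j ∈ Sᶜ, y j := by
      intro i hi
      rw [Finset.prod_erase_mul S y hi, Finset.compl_erase, Finset.sum_insert (by simp [hi])]
      ring
    rw [Finset.sum_congr rfl h2, Finset.sum_const, (mem_powersetCard.1 hS).2]
    simp
  -- Cauchy–Schwarz on each complement, which has n - k elements; removing the diagonal turns the
  -- factor n - k into n - k - 1.
  have hkey : ((k : ℝ) + 1) * E ≤ ((Fintype.card ι : ℝ) - (k + 1)) * A := by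
    rw [hE2, hA2, Finset.mul_sum]
    refine Finset.sum_le_sum fun K hK => ?_
    have hc : ((Kᶜ.card : ℕ) : ℝ) = (Fintype.card ι : ℝ) - k := by
      rw [Finset.card_compl, Nat.cast_sub (Finset.card_le_univ K), (mem_powersetCard.1 hK).2]
    have hcs := sq_sum_le_card_mul_sum_sq (s := Kᶜ) (f := y)
    rw [hc] at hcs
    have hp : 0 ≤ ∏ j ∈ K, y j := Finset.prod_nonneg fun j _ => hy j
    nlinarith [mul_le_mul_of_nonneg_left hcs hp]
  rw [hsplit]
  push_cast
  linarith

/-- Maclaurin's inequality: the normalized elementary symmetric mean of nonnegative numbers is at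
most the corresponding power of the arithmetic mean. -/
lemma sum_powersetCard_prod_le (p : ℕ) {y : ι → ℝ} (hy : ∀ i, 0 ≤ y i) :
    (∑ S ∈ powersetCard p univ, ∏ i ∈ S, y i) * (Fintype.card ι : ℝ) ^ p
      ≤ (Fintype.card ι).choose p * (∑ i, y i) ^ p := by
  induction p with
  | zero => simp
  | succ p ih =>
    have hs : 0 ≤ ∑ i, y i := Finset.sum_nonneg fun i _ => hy i
    rcases lt_or_ge (Fintype.card ι) (p + 1) with h | h
    · rw [Finset.powersetCard_eq_empty.2 (by simpa using h)]
      simp only [sum_empty, zero_mul]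
      positivity
    have hc : ((Fintype.card ι).choose (p + 1) : ℝ) * ((p : ℝ) + 1)
        = (Fintype.card ι).choose p * ((Fintype.card ι : ℝ) - p) := by
      have := Nat.choose_succ_right_eq (Fintype.card ι) p
      rw [← Nat.cast_sub (by omega)]
      exact_mod_cast this
    have hnp : (0 : ℝ) ≤ (Fintype.card ι : ℝ) - p := by
      rw [sub_nonneg]
      exact_mod_cast (by omega : p ≤ Fintype.card ι)
    have hstep := card_mul_sum_powersetCard_succ_le p hy
    refine le_of_mul_le_mul_left ?_ (by positivity : (0 : ℝ) < (p : ℝ) + 1)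
    calc ((p : ℝ) + 1) * ((∑ S ∈ powersetCard (p + 1) univ, ∏ i ∈ S, y i)
            * (Fintype.card ι : ℝ) ^ (p + 1))
        = ((Fintype.card ι : ℝ) * (((p : ℝ) + 1) *
            ∑ S ∈ powersetCard (p + 1) univ, ∏ i ∈ S, y i)) * (Fintype.card ι : ℝ) ^ p := by ring
      _ ≤ (((Fintype.card ι : ℝ) - p) * ((∑ i, y i) *
            ∑ S ∈ powersetCard p univ, ∏ i ∈ S, y i)) * (Fintype.card ι : ℝ) ^ p := by gcongr
      _ = ((Fintype.card ι : ℝ) - p) * (∑ i, y i) *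
            ((∑ S ∈ powersetCard p univ, ∏ i ∈ S, y i) * (Fintype.card ι : ℝ) ^ p) := by ring
      _ ≤ ((Fintype.card ι : ℝ) - p) * (∑ i, y i) *
            ((Fintype.card ι).choose p * (∑ i, y i) ^ p) := by gcongr
      _ = ((Fintype.card ι).choose p * ((Fintype.card ι : ℝ) - p)) * (∑ i, y i) ^ (p + 1) := by
            ring
      _ = _ := by rw [← hc]; ring

end Maclaurin

/-! ### Fractional moments of Poisson and zero-truncated Poisson likelihood ratios. -/

section Affinity

lemma exp_neg_le_one_sub_half {v : ℝ} (h0 : 0 ≤ v) (h1 : v ≤ 1) : Real.exp (-v) ≤ 1 - v / 2 := by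
  rw [Real.exp_neg, inv_le_comm₀ (Real.exp_pos v) (by linarith)]
  refine le_trans ?_ (Real.add_one_le_exp v)
  rw [inv_le_iff_one_le_mul₀ (by linarith)]
  nlinarith

lemma sq_sub_div_le_sq_sqrt_sub {α m t : ℝ} (hα : 0 < α) (hm : 0 ≤ m) (ht : 0 ≤ t)
    (hmα : m ≤ 2 * α) (htα : t ≤ 2 * α) :
    (m - t) ^ 2 / (8 * α) ≤ (√m - √t) ^ 2 := by
  rw [div_le_iff₀ (by positivity)]
  have h1 := Real.sq_sqrt hm
  have h2 := Real.sq_sqrt ht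
  have h3 : (√m + √t) ^ 2 ≤ 8 * α := by nlinarith [sq_nonneg (√m - √t)]
  calc (m - t) ^ 2 = (√m - √t) ^ 2 * (√m + √t) ^ 2 := by
        rw [← h1, ← h2, Real.sqrt_sq (Real.sqrt_nonneg m), Real.sqrt_sq (Real.sqrt_nonneg t)]
        ring
    _ ≤ _ := by gcongr

/-- The weighted geometric mean falls short of the arithmetic one by a Hellinger distance. -/
lemma exp_weighted_log_le {s m t : ℝ} (hs0 : 0 ≤ s) (hs : s ≤ 1 / 2) (hm : 0 < m) (ht : 0 < t) :
    Real.exp ((1 - s) * Real.log m + s * Real.log t)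
      ≤ (1 - s) * m + s * t - s * (√m - √t) ^ 2 := by
  -- As s ≤ 1/2, the exponent mixes log m and the midpoint of log m and log t with weights 1-2s and
  -- 2s. At the midpoint the AM–GM deficit is exactly (√m - √t)²/2.
  have hc := convexOn_exp.2 (Set.mem_univ (Real.log m))
    (Set.mem_univ ((Real.log m + Real.log t) / 2)) (by linarith : (0 : ℝ) ≤ 1 - 2 * s)
    (by linarith : (0 : ℝ) ≤ 2 * s) (by ring)
  have hsq : Real.exp ((Real.log m + Real.log t) / 2) = √m * √t := by
    rw [add_div, Real.exp_add, ← Real.log_sqrt hm.le, ← Real.log_sqrt ht.le,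
      Real.exp_log (Real.sqrt_pos.2 hm), Real.exp_log (Real.sqrt_pos.2 ht)]
  simp only [smul_eq_mul, Real.exp_log hm, hsq] at hc
  have h1 := Real.sq_sqrt hm.le
  have h2 := Real.sq_sqrt ht.le
  calc _ = Real.exp ((1 - 2 * s) * Real.log m + 2 * s * ((Real.log m + Real.log t) / 2)) := by
        congr 1; ring
    _ ≤ _ := hc
    _ = (1 - s) * m + s * t - s * (m + t - 2 * (√m * √t)) := by ring
    _ = _ := by linear_combination s * h1 + s * h2

/-- The share of a zero-truncated Poisson observation in the information on its mean. -/
noncomputable def ztRatio (β : ℝ) : ℝ := (Real.exp β - 1 - β) / (Real.exp β - 1)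

lemma exp_sub_one_pos {t : ℝ} (ht : 0 < t) : 0 < Real.exp t - 1 := by
  have := Real.add_one_lt_exp ht.ne'
  linarith

lemma ztRatio_nonneg {β : ℝ} (hβ : 0 < β) : 0 ≤ ztRatio β :=
  div_nonneg (by linarith [Real.add_one_le_exp β]) (exp_sub_one_pos hβ).le

lemma ztRatio_le_one {β : ℝ} (hβ : 0 < β) : ztRatio β ≤ 1 := by
  rw [ztRatio, div_le_one (exp_sub_one_pos hβ)]
  linarith

lemma div_exp_sub_one_antitone {β t : ℝ} (hβ : 0 < β) (ht : β ≤ t) :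
    t / (Real.exp t - 1) ≤ β / (Real.exp β - 1) := by
  rw [div_le_div_iff₀ (exp_sub_one_pos (hβ.trans_le ht)) (exp_sub_one_pos hβ)]
  obtain ⟨d, hd, rfl⟩ : ∃ d, 0 ≤ d ∧ t = β + d := ⟨t - β, by linarith, by ring⟩
  rw [Real.exp_add]
  have h1 := Real.add_one_le_exp d
  have h2 := Real.add_one_le_exp (-β)
  have h3 : Real.exp β * Real.exp (-β) = 1 := by rw [← Real.exp_add]; simp
  have h4 : Real.exp β - 1 ≤ β * Real.exp β := by
    nlinarith [mul_le_mul_of_nonneg_left h2 (Real.exp_pos β).le]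
  have h5 := mul_le_mul_of_nonneg_left h1 (by positivity : 0 ≤ β * Real.exp β)
  nlinarith [mul_le_mul_of_nonneg_left h4 hd]

/-- Since t e^t/(e^t-1) = t + t/(e^t-1), the difference equals β/(e^β-1) · t + t/(e^t-1). The second
summand decreases no faster than its own value, which on [β, ∞) is at most β/(e^β-1), so the linear
term compensates. -/
lemma ztMean_sub_mono {β t u : ℝ} (hβ : 0 < β) (ht : β ≤ t) (hu : t ≤ u) :
    t * Real.exp t / (Real.exp t - 1) - ztRatio β * t
      ≤ u * Real.exp u / (Real.exp u - 1) - ztRatio β * u := by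
  have ht0 : 0 < t := hβ.trans_le ht
  have hu0 : 0 < u := ht0.trans_le hu
  have hrep : ∀ v, 0 < v → v * Real.exp v / (Real.exp v - 1) - ztRatio β * v
      = β / (Real.exp β - 1) * v + v / (Real.exp v - 1) := by
    intro v hv
    have h1 := (exp_sub_one_pos hv).ne'
    have h2 := (exp_sub_one_pos hβ).ne'
    rw [ztRatio]
    field_simp
    ring
  rw [hrep t ht0, hrep u hu0]
  have hj := div_exp_sub_one_antitone hβ ht
  suffices h : t / (Real.exp t - 1) * (1 - (u - t)) ≤ u / (Real.exp u - 1) by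
    nlinarith [mul_le_mul_of_nonneg_right hj (sub_nonneg.2 hu)]
  obtain ⟨d, hd, rfl⟩ : ∃ d, 0 ≤ d ∧ u = t + d := ⟨u - t, by linarith, by ring⟩
  have hdexp : 1 - (t + d - t) ≤ Real.exp (-d) := by linarith [Real.add_one_le_exp (-d)]
  have hpos : 0 ≤ t / (Real.exp t - 1) := div_nonneg ht0.le (exp_sub_one_pos ht0).le
  refine (mul_le_mul_of_nonneg_left hdexp hpos).trans ?_
  rw [div_mul_eq_mul_div, div_le_div_iff₀ (exp_sub_one_pos ht0) (exp_sub_one_pos hu0),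
    Real.exp_add]
  have h3 : Real.exp (-d) * Real.exp d = 1 := by rw [← Real.exp_add]; simp
  have h4 : t * Real.exp (-d) * (Real.exp t * Real.exp d - 1)
      = t * Real.exp t * (Real.exp (-d) * Real.exp d) - t * Real.exp (-d) := by ring
  rw [h4, h3]
  have h5 := Real.add_one_le_exp (-d)
  have h6 := Real.add_one_le_exp t
  nlinarith [mul_le_mul_of_nonneg_left h5 ht0.le, mul_le_mul_of_nonneg_left h6 hd]

/-- In the natural parameter θ = log t the derivative is the monotone function of `ztMean_sub_mono`.
Convexity says that the Jensen gap of the truncated log-partition is at least `ztRatio β` times that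
of the Poisson one, e^θ. -/
lemma convexOn_ztLogPartition {β : ℝ} (hβ : 0 < β) :
    ConvexOn ℝ (Set.Ici (Real.log β))
      (fun θ => Real.log (Real.exp (Real.exp θ) - 1) - ztRatio β * Real.exp θ) := by
  have hd : ∀ θ : ℝ, HasDerivAt
      (fun θ => Real.log (Real.exp (Real.exp θ) - 1) - ztRatio β * Real.exp θ)
      (Real.exp θ * Real.exp (Real.exp θ) / (Real.exp (Real.exp θ) - 1)
        - ztRatio β * Real.exp θ) θ := by
    intro θ
    have h1 := ((Real.hasDerivAt_exp θ).exp.sub_const 1).log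
      (exp_sub_one_pos (Real.exp_pos θ)).ne'
    have h2 := (Real.hasDerivAt_exp θ).const_mul (ztRatio β)
    convert! h1.sub h2 using 1
    ring
  refine MonotoneOn.convexOn_of_deriv (convex_Ici _)
    (fun θ _ => (hd θ).continuousAt.continuousWithinAt)
    (fun θ _ => (hd θ).differentiableAt.differentiableWithinAt) ?_
  intro x hx y _ hxy
  rw [interior_Ici] at hx
  rw [(hd x).deriv, (hd y).deriv]
  refine ztMean_sub_mono hβ ?_ (Real.exp_le_exp.2 hxy)
  rw [← Real.exp_log hβ]
  exact Real.exp_le_exp.2 (le_of_lt hx)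

/-- The contribution of one count to the Poisson log-likelihood. -/
noncomputable def poissonTerm (k : ℕ) (t : ℝ) : ℝ :=
  (k : ℝ) * Real.log t - t - Real.log (k.factorial : ℝ)

/-- The contribution of one count to the zero-truncated Poisson log-likelihood; a zero count does
not contribute. -/
noncomputable def ztTerm (k : ℕ) (t : ℝ) : ℝ :=
  if k = 0 then 0 else
    (k : ℝ) * Real.log t - Real.log (Real.exp t - 1) - Real.log (k.factorial : ℝ)

lemma poissonTerm_le {k : ℕ} {t u : ℝ} (ht : 0 < t) (hu : t ≤ u) :
    poissonTerm k t ≤ poissonTerm k u + 1 * (u - t) := by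
  have h := mul_le_mul_of_nonneg_left (Real.log_le_log ht hu) (Nat.cast_nonneg (α := ℝ) k)
  unfold poissonTerm
  linarith

/-- Only log(e^t - 1) can cause a loss, and its slope 1 + 1/(e^t - 1) is at most 1 + 1/β; the
constant is uniform in `k`. -/
lemma ztTerm_le {k : ℕ} {β t u : ℝ} (hβ : 0 < β) (ht : β ≤ t) (hu : t ≤ u) :
    ztTerm k t ≤ ztTerm k u + (1 + 1 / β) * (u - t) := by
  have ht0 : 0 < t := hβ.trans_le ht
  have hu0 : 0 < u := ht0.trans_le hu
  unfold ztTerm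
  split_ifs with hk
  · have : 0 ≤ (1 + 1 / β) * (u - t) := mul_nonneg (by positivity) (by linarith)
    linarith
  have h := mul_le_mul_of_nonneg_left (Real.log_le_log ht0 hu) (Nat.cast_nonneg (α := ℝ) k)
  suffices h' : Real.log (Real.exp u - 1) ≤ Real.log (Real.exp t - 1) + (1 + 1 / β) * (u - t) by
    linarith
  obtain ⟨d, hd, rfl⟩ : ∃ d, 0 ≤ d ∧ u = t + d := ⟨u - t, by linarith, by ring⟩
  have hX := exp_sub_one_pos ht0
  have hY := exp_sub_one_pos hu0
  have hlog := Real.log_le_sub_one_of_pos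
    (div_pos (mul_pos hY (Real.exp_pos (-d))) hX)
  rw [Real.log_div (mul_pos hY (Real.exp_pos (-d))).ne' hX.ne',
    Real.log_mul hY.ne' (Real.exp_pos _).ne', Real.log_exp] at hlog
  have h3 : Real.exp d * Real.exp (-d) = 1 := by rw [← Real.exp_add]; simp
  have h4 : (Real.exp (t + d) - 1) * Real.exp (-d) / (Real.exp t - 1) - 1
      = (1 - Real.exp (-d)) / (Real.exp t - 1) := by
    rw [Real.exp_add, sub_mul, mul_assoc, h3]
    field_simp
    ring
  have h5 : (1 - Real.exp (-d)) / (Real.exp t - 1) ≤ d / β :=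
    div_le_div₀ hd (by linarith [Real.add_one_le_exp (-d)]) hβ
      (by linarith [Real.add_one_le_exp t])
  have h6 : (1 + 1 / β) * (t + d - t) = d + d / β := by ring
  rw [h6]
  linarith

lemma lintegral_poissonMeasure_of_hasSum {m A : ℝ} (hm : 0 ≤ m) {f : ℕ → ℝ} (hf : ∀ k, 0 ≤ f k)
    (h : HasSum (fun k => Real.exp (-m) * m ^ k / (k.factorial : ℝ) * f k) A) :
    ∫⁻ k, ENNReal.ofReal (f k) ∂(poissonMeasure m.toNNReal) = ENNReal.ofReal A := by
  rw [poissonMeasure, lintegral_sum_measure]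
  simp_rw [lintegral_smul_measure, lintegral_dirac, smul_eq_mul, Real.coe_toNNReal m hm]
  rw [← h.tsum_eq, ENNReal.ofReal_tsum_of_nonneg (fun k => mul_nonneg (by positivity) (hf k))
    h.summable]
  refine tsum_congr fun k => ?_
  rw [ENNReal.ofReal_mul (by positivity)]

lemma hasSum_poisson_mul_geometric (m a b q : ℝ) :
    HasSum (fun k : ℕ => Real.exp (-m) * m ^ k / (k.factorial : ℝ) *
        (if k = 0 then a else b * q ^ k))
      (Real.exp (-m) * (a + b * (Real.exp (m * q) - 1))) := by
  have h1 := (NormedSpace.expSeries_div_hasSum_exp (m * q)).mul_left (Real.exp (-m) * b)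
  rw [← Real.exp_eq_exp_ℝ] at h1
  -- Corrects the term k = 0 of the exponential series from b to a.
  have h2 := hasSum_ite_eq (0 : ℕ) (Real.exp (-m) * (a - b))
  convert! h1.add h2 using 1
  · funext k
    split_ifs with hk
    · subst hk; simp; ring
    · rw [mul_pow]; ring
  · ring

lemma exp_mul_log_sub (k : ℕ) (s a b : ℝ) :
    Real.exp (s * (k * a - k * b)) = Real.exp (s * (a - b)) ^ k := by
  rw [← Real.exp_nat_mul]
  congr 1
  ring

lemma mul_exp_log_sub {s m t : ℝ} (hm : 0 < m) :
    m * Real.exp (s * (Real.log t - Real.log m))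
      = Real.exp ((1 - s) * Real.log m + s * Real.log t) := by
  nth_rewrite 1 [← Real.exp_log hm]
  rw [← Real.exp_add]
  congr 1
  ring

/-- The exponent at which likelihood ratios are integrated. -/
noncomputable def chernoffExp (α : ℝ) : ℝ := 1 / (2 * (1 + α))

/-- The moment is exactly exp(m^(1-s) t^s - (1-s)m - st), so the weighted AM–GM gap is the exponent.
Allowing t up to 2α leaves room for rounded candidates. -/
lemma lintegral_exp_poissonTerm_le {α m t : ℝ} (hm : 0 < m) (ht : 0 < t) (hmα : m ≤ α)
    (htα : t ≤ 2 * α) :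
    ∫⁻ k, ENNReal.ofReal (Real.exp (chernoffExp α * (poissonTerm k t - poissonTerm k m)))
        ∂(poissonMeasure m.toNNReal)
      ≤ ENNReal.ofReal (1 - 1 / (32 * α * (1 + α)) * (m - t) ^ 2) := by
  have hα : 0 < α := hm.trans_le hmα
  set s := chernoffExp α with hs
  have hs0 : 0 ≤ s := by rw [hs, chernoffExp]; positivity
  have hs1 : s ≤ 1 / 2 := by
    rw [hs, chernoffExp]
    exact one_div_le_one_div_of_le (by norm_num) (by linarith)
  have hf : ∀ k : ℕ, Real.exp (s * (poissonTerm k t - poissonTerm k m))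
      = if k = 0 then Real.exp (-(s * (t - m))) else
        Real.exp (-(s * (t - m))) * Real.exp (s * (Real.log t - Real.log m)) ^ k := by
    intro k
    have : Real.exp (s * (poissonTerm k t - poissonTerm k m))
        = Real.exp (-(s * (t - m))) * Real.exp (s * (Real.log t - Real.log m)) ^ k := by
      rw [← exp_mul_log_sub, ← Real.exp_add]
      congr 1
      unfold poissonTerm
      ring
    rw [this]
    split_ifs with hk
    · simp [hk]
    · rfl
  have hsum := hasSum_poisson_mul_geometric m (Real.exp (-(s * (t - m))))
    (Real.exp (-(s * (t - m)))) (Real.exp (s * (Real.log t - Real.log m)))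
  simp_rw [← hf] at hsum
  rw [lintegral_poissonMeasure_of_hasSum hm.le (fun k => (Real.exp_pos _).le) hsum]
  refine ENNReal.ofReal_le_ofReal ?_
  rw [mul_exp_log_sub hm]
  set y := Real.exp ((1 - s) * Real.log m + s * Real.log t) with hy
  have hy1 := exp_weighted_log_le hs0 hs1 hm ht
  have hh := mul_le_mul_of_nonneg_left
    (sq_sub_div_le_sq_sqrt_sub hα hm.le ht.le (by linarith) htα) hs0
  have hw : s * ((m - t) ^ 2 / (8 * α)) = (m - t) ^ 2 / (16 * α * (1 + α)) := by
    rw [hs, chernoffExp]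
    field_simp
    ring
  have hw1 : (m - t) ^ 2 / (16 * α * (1 + α)) ≤ 1 := by
    rw [div_le_one (by positivity)]
    nlinarith
  have he := exp_neg_le_one_sub_half (by positivity) hw1
  calc _ = Real.exp (-m + -(s * (t - m)) + y) := by
        rw [Real.exp_add, Real.exp_add]; ring
    _ ≤ Real.exp (-((m - t) ^ 2 / (16 * α * (1 + α)))) := by
        refine Real.exp_le_exp.2 ?_
        rw [← hw]
        linarith
    _ ≤ _ := he
    _ = _ := by field_simp; ring

/-- A zero count contributes the factor 1, so there is a gain only on nonzero counts, of probability
1 - e^(-m) ≥ 1 - e^(-β). There the gap in the exponent is at least `ztRatio β` times the Poisson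
gap, by `convexOn_ztLogPartition`. -/
lemma lintegral_exp_ztTerm_le {α β m t : ℝ} (hβ : 0 < β) (hm : β ≤ m) (ht : β ≤ t) (hmα : m ≤ α)
    (htα : t ≤ 2 * α) :
    ∫⁻ k, ENNReal.ofReal (Real.exp (chernoffExp α * (ztTerm k t - ztTerm k m)))
        ∂(poissonMeasure m.toNNReal)
      ≤ ENNReal.ofReal (1 - (Real.exp β - 1 - β) * Real.exp (-β) / (32 * α * (1 + α))
          * (m - t) ^ 2) := by
  have hm0 : 0 < m := hβ.trans_le hm
  have ht0 : 0 < t := hβ.trans_le ht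
  have hα : 0 < α := hm0.trans_le hmα
  set s := chernoffExp α with hs
  have hs0 : 0 ≤ s := by rw [hs, chernoffExp]; positivity
  have hs1 : s ≤ 1 / 2 := by
    rw [hs, chernoffExp]
    exact one_div_le_one_div_of_le (by norm_num) (by linarith)
  set b := Real.exp (-(s * (Real.log (Real.exp t - 1) - Real.log (Real.exp m - 1)))) with hb
  have hf : ∀ k : ℕ, Real.exp (s * (ztTerm k t - ztTerm k m))
      = if k = 0 then 1 else b * Real.exp (s * (Real.log t - Real.log m)) ^ k := by
    intro k
    unfold ztTerm
    split_ifs with hk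
    · simp
    · rw [hb, ← exp_mul_log_sub, ← Real.exp_add]
      congr 1
      ring
  have hsum := hasSum_poisson_mul_geometric m 1 b (Real.exp (s * (Real.log t - Real.log m)))
  simp_rw [← hf] at hsum
  rw [lintegral_poissonMeasure_of_hasSum hm0.le (fun k => (Real.exp_pos _).le) hsum]
  refine ENNReal.ofReal_le_ofReal ?_
  rw [mul_exp_log_sub hm0]
  have hy1 := exp_weighted_log_le hs0 hs1 hm0 ht0
  have hconv := (convexOn_ztLogPartition hβ).2 (Set.mem_Ici.2 (Real.log_le_log hβ hm))
    (Set.mem_Ici.2 (Real.log_le_log hβ ht)) (by linarith : (0 : ℝ) ≤ 1 - s) hs0 (by ring)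
  simp only [smul_eq_mul, Real.exp_log hm0, Real.exp_log ht0] at hconv
  set y := Real.exp ((1 - s) * Real.log m + s * Real.log t) with hy
  have hh := mul_le_mul_of_nonneg_left
    (sq_sub_div_le_sq_sqrt_sub hα hm0.le ht0.le (by linarith) htα) hs0
  have hw : s * ((m - t) ^ 2 / (8 * α)) = (m - t) ^ 2 / (16 * α * (1 + α)) := by
    rw [hs, chernoffExp]
    field_simp
    ring
  rw [hw] at hh
  set w := (m - t) ^ 2 / (16 * α * (1 + α)) with hwdef
  have hw0 : 0 ≤ w := by positivity
  have hw1 : w ≤ 1 := by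
    rw [hwdef, div_le_one (by positivity)]
    nlinarith
  have hρ0 := ztRatio_nonneg hβ
  have hρ1 := ztRatio_le_one hβ
  have hgap := mul_le_mul_of_nonneg_left
    (show w ≤ (1 - s) * m + s * t - y by linarith) hρ0
  have hM := exp_sub_one_pos hm0
  have hY : 0 < Real.exp y - 1 := exp_sub_one_pos (Real.exp_pos _)
  have hBC : b * (Real.exp y - 1) ≤ (Real.exp m - 1) * Real.exp (-(ztRatio β * w)) := by
    have h1 : b * (Real.exp y - 1) = Real.exp (-(s * (Real.log (Real.exp t - 1)
        - Real.log (Real.exp m - 1))) + Real.log (Real.exp y - 1)) := by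
      rw [Real.exp_add, Real.exp_log hY]
    have h2 : (Real.exp m - 1) * Real.exp (-(ztRatio β * w))
        = Real.exp (Real.log (Real.exp m - 1) + -(ztRatio β * w)) := by
      rw [Real.exp_add, Real.exp_log hM]
    rw [h1, h2]
    exact Real.exp_le_exp.2 (by linarith)
  have he := exp_neg_le_one_sub_half (mul_nonneg hρ0 hw0) (mul_le_one₀ hρ1 hw0 hw1)
  have hem : Real.exp (-m) * Real.exp m = 1 := by rw [← Real.exp_add]; simp
  have hτ : (1 - Real.exp (-β)) * ztRatio β = (Real.exp β - 1 - β) * Real.exp (-β) := by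
    have h2 := (exp_sub_one_pos hβ).ne'
    rw [ztRatio, Real.exp_neg]
    field_simp
  have hmono : Real.exp (-m) ≤ Real.exp (-β) := Real.exp_le_exp.2 (by linarith)
  have hm1 : Real.exp (-m) ≤ 1 := Real.exp_le_one_iff.2 (by linarith)
  calc Real.exp (-m) * (1 + b * (Real.exp y - 1))
      ≤ Real.exp (-m) * (1 + (Real.exp m - 1) * (1 - ztRatio β * w / 2)) := by
        have := hBC.trans (mul_le_mul_of_nonneg_left he hM.le)
        gcongr
    _ = 1 - (1 - Real.exp (-m)) * (ztRatio β * w / 2) := by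
        linear_combination (1 - ztRatio β * w / 2) * hem
    _ ≤ 1 - (1 - Real.exp (-β)) * (ztRatio β * w / 2) := by
        have h0 : 0 ≤ ztRatio β * w / 2 := by positivity
        nlinarith
    _ = 1 - ((1 - Real.exp (-β)) * ztRatio β) * w / 2 := by ring
    _ = _ := by rw [hτ, hwdef]; field_simp; ring

end Affinity

/-! ### Upward rounding of nonnegative factors to a finite grid. -/

section Rounding

lemma prod_sub_prod_le_sum_sub {ι : Type*} (s : Finset ι) {a b : ι → ℝ} (ha : ∀ i, 0 ≤ a i)
    (hab : ∀ i, a i ≤ b i) (hb : ∀ i, b i ≤ 1) :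
    ∏ i ∈ s, b i - ∏ i ∈ s, a i ≤ ∑ i ∈ s, (b i - a i) := by
  classical
  induction s using Finset.induction_on with
  | empty => simp
  | insert j s hj ih =>
    rw [Finset.prod_insert hj, Finset.prod_insert hj, Finset.sum_insert hj]
    have h0 : 0 ≤ ∏ i ∈ s, a i := Finset.prod_nonneg fun i _ => ha i
    have h1 : ∏ i ∈ s, b i ≤ 1 :=
      Finset.prod_le_one (fun i _ => (ha i).trans (hab i)) fun i _ => hb i
    have h2 : ∏ i ∈ s, a i ≤ ∏ i ∈ s, b i :=
      Finset.prod_le_prod (fun i _ => ha i) fun i _ => hab i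
    nlinarith [mul_le_mul_of_nonneg_right ((hab j).trans (hb j)) (sub_nonneg.2 h2),
      mul_le_mul_of_nonneg_left h1 (sub_nonneg.2 (hab j)),
      mul_le_mul_of_nonneg_left (h2.trans h1) (sub_nonneg.2 (hab j)),
      mul_le_mul_of_nonneg_right (hb j) (sub_nonneg.2 h2)]

variable {N : ℕ} {d : Fin N → ℕ}

/-- Pads with zero factors; for N = 0 the padded empty products would be 1 instead of 0. -/
lemma HasNNCP.mono (hN : 1 ≤ N) {T : Tensor d} {R R' : ℕ} (h : HasNNCP T R) (hR : R ≤ R') :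
    HasNNCP T R' := by
  obtain ⟨a, ha, hT⟩ := h
  obtain ⟨k, rfl⟩ := Nat.exists_eq_add_of_le hR
  refine ⟨Fin.append a fun _ _ _ => 0, fun r => ?_, fun i => ?_⟩
  · refine Fin.addCases (fun r n j => ?_) (fun r n j => ?_) r
    · simpa using ha r n j
    · simp
  · have : Nonempty (Fin N) := ⟨⟨0, hN⟩⟩
    rw [hT, Fin.sum_univ_add]
    simp
    omega

lemma hasNNCP_of_nnRank_le (hN : 1 ≤ N) {T : Tensor d} {R : ℕ} (h : nnRank T ≤ R) :
    HasNNCP T R := by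
  have hlt : nnRank T < ((R + 1 : ℕ) : ℕ∞) :=
    h.trans_lt (by exact_mod_cast Nat.lt_succ_self R)
  obtain ⟨R', hR'⟩ := iInf_lt_iff.1 hlt
  obtain ⟨hT, hR'⟩ := iInf_lt_iff.1 hR'
  have : R' < R + 1 := by exact_mod_cast hR'
  exact hT.mono hN (by omega)

/-- Divide each vector by its maximum. The product of the maxima is itself an entry, hence at most
α, and its ratio to α is absorbed into the first mode. -/
lemma exists_unit_factors (hN : 1 ≤ N) (hd : ∀ n, 1 ≤ d n) {α : ℝ} (hα : 0 < α)
    {a : ∀ n : Fin N, Fin (d n) → ℝ} (ha : ∀ n j, 0 ≤ a n j)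
    (hle : ∀ i : MultiIndex d, ∏ n, a n (i n) ≤ α) :
    ∃ u : ∀ n : Fin N, Fin (d n) → ℝ, (∀ n j, 0 ≤ u n j ∧ u n j ≤ 1) ∧
      ∀ i : MultiIndex d, ∏ n, a n (i n) = α * ∏ n, u n (i n) := by
  have hmax : ∀ n, ∃ j, ∀ j', a n j' ≤ a n j := fun n =>
    have : Nonempty (Fin (d n)) := ⟨⟨0, hd n⟩⟩
    Finite.exists_max (a n)
  choose c hc using hmax
  set l := ∏ n, a n (c n) with hl
  have hl0 : 0 ≤ l := Finset.prod_nonneg fun n _ => ha n _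
  have hw : 0 ≤ l / α ∧ l / α ≤ 1 := ⟨by positivity, (div_le_one hα).2 (hle c)⟩
  let z : Fin N := ⟨0, hN⟩
  refine ⟨fun n j => a n j / a n (c n) * if n = z then l / α else 1, fun n j => ?_, fun i => ?_⟩
  · have h1 : 0 ≤ a n j / a n (c n) := div_nonneg (ha n j) (ha n _)
    have h2 : a n j / a n (c n) ≤ 1 := div_le_one_of_le₀ (hc n j) (ha n _)
    dsimp only
    split_ifs
    · exact ⟨mul_nonneg h1 hw.1, mul_le_one₀ h2 hw.1 hw.2⟩
    · exact ⟨by simpa using h1, by simpa using h2⟩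
  · dsimp only
    rw [Finset.prod_mul_distrib, Finset.prod_ite_eq' Finset.univ z]
    simp only [Finset.mem_univ, if_true]
    rw [Finset.prod_congr rfl fun n _ => show a n (i n) = a n (i n) / a n (c n) * a n (c n) from ?_,
      Finset.prod_mul_distrib, ← hl]
    · field_simp
    -- A zero maximum forces the whole vector to vanish, so division by zero returning 0 is
    -- harmless.
    · by_cases h : a n (c n) = 0
      · rw [h, mul_zero]
        exact le_antisymm (h ▸ hc n (i n)) (ha n _)
      · field_simp

/-- The tensor with rank-one factors on the grid `{0, 1 / K, …, 1}`, scaled by `α`. -/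
noncomputable def gridTensor (α : ℝ) (K : ℕ) {R : ℕ}
    (g : Fin R → ∀ n : Fin N, Fin (d n) → Fin (K + 1)) : Tensor d :=
  fun i => α * ∑ r, ∏ n, ((g r n (i n) : ℕ) : ℝ) / K

lemma card_grid (K R : ℕ) :
    Fintype.card (Fin R → ∀ n : Fin N, Fin (d n) → Fin (K + 1)) = (K + 1) ^ (R * ∑ n, d n) := by
  simp only [Fintype.card_pi, Fintype.card_fin, Finset.prod_const, Finset.card_univ]
  rw [Finset.prod_pow_eq_pow_sum, ← pow_mul, mul_comm]

/-- Ceilings on the grid move each of the N factors in [0, 1] by at most 1/K, so each of the R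
products moves by at most N/K. -/
lemma exists_gridTensor_ge (hN : 1 ≤ N) (hd : ∀ n, 1 ≤ d n) {α β : ℝ} (hβ : 0 < β)
    (hβα : β ≤ α) {R K : ℕ} (hK : 1 ≤ K) {T : Tensor d} (hT : T ∈ searchSpace d R β α) :
    ∃ g : Fin R → ∀ n : Fin N, Fin (d n) → Fin (K + 1), ∀ i,
      T i ≤ gridTensor α K g i ∧ gridTensor α K g i ≤ T i + α * (R * N / K) := by
  have hα : 0 < α := hβ.trans_le hβα
  have hK0 : (0 : ℝ) < K := by exact_mod_cast hK
  obtain ⟨a, ha, hTa⟩ := hasNNCP_of_nnRank_le hN hT.2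
  have hle : ∀ r (i : MultiIndex d), ∏ n, a r n (i n) ≤ α := fun r i => by
    refine le_trans ?_ (hT.1 i).2
    rw [hTa]
    exact Finset.single_le_sum (f := fun r => ∏ n, a r n (i n))
      (fun r _ => Finset.prod_nonneg fun n _ => ha r n _) (Finset.mem_univ r)
  choose u hu hau using fun r => exists_unit_factors hN hd hα (ha r) (hle r)
  have hceil : ∀ r n j, ⌈(K : ℝ) * u r n j⌉₊ < K + 1 := fun r n j => by
    rw [Nat.lt_succ_iff, Nat.ceil_le]
    exact mul_le_of_le_one_right hK0.le (hu r n j).2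
  refine ⟨fun r n j => ⟨⌈(K : ℝ) * u r n j⌉₊, hceil r n j⟩, fun i => ?_⟩
  have hTu : T i = α * ∑ r, ∏ n, u r n (i n) := by
    rw [hTa, Finset.mul_sum]
    exact Finset.sum_congr rfl fun r _ => hau r i
  have hlow : ∀ r n, u r n (i n) ≤ (⌈(K : ℝ) * u r n (i n)⌉₊ : ℝ) / K := fun r n => by
    rw [le_div_iff₀ hK0, mul_comm]
    exact Nat.le_ceil _
  have hup : ∀ r n, (⌈(K : ℝ) * u r n (i n)⌉₊ : ℝ) / K - u r n (i n) ≤ 1 / K := fun r n => by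
    rw [sub_le_iff_le_add, div_le_iff₀ hK0, add_mul, one_div_mul_cancel hK0.ne']
    have := Nat.ceil_lt_add_one (mul_nonneg hK0.le (hu r n (i n)).1)
    linarith
  have hone : ∀ r n, (⌈(K : ℝ) * u r n (i n)⌉₊ : ℝ) / K ≤ 1 := fun r n => by
    rw [div_le_one hK0]
    exact_mod_cast Nat.lt_succ_iff.1 (hceil r n (i n))
  simp only [gridTensor]
  constructor
  · rw [hTu]
    refine mul_le_mul_of_nonneg_left (Finset.sum_le_sum fun r _ => ?_) hα.le
    exact Finset.prod_le_prod (fun n _ => (hu r n _).1) fun n _ => hlow r n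
  · rw [hTu, ← mul_add]
    refine mul_le_mul_of_nonneg_left ?_ hα.le
    rw [← sub_le_iff_le_add', ← Finset.sum_sub_distrib]
    calc _ ≤ ∑ _r : Fin R, (N / K : ℝ) := by
          refine Finset.sum_le_sum fun r _ => ?_
          refine (prod_sub_prod_le_sum_sub Finset.univ (fun n => (hu r n (i n)).1) (hlow r)
            (hone r)).trans ?_
          refine (Finset.sum_le_sum fun n _ => hup r n).trans ?_
          simp [div_eq_mul_inv]
      _ = _ := by simp [mul_div_assoc]

end Rounding

/-! ### Markov's inequality for the weighted sum of likelihood ratios. -/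

section Deviation

open scoped ENNReal

variable {N : ℕ} {d : Fin N → ℕ} {W : Type*} [MeasurableSpace W] {μ : Measure W}
  {M : Tensor d} {p : ℕ} {Ω : W → Finset (MultiIndex d)} {X : W → MultiIndex d → ℕ}

lemma lintegral_cond_exp_sum_le (h : IsPoissonSample μ M p Ω X) {φ : ℕ → ℝ → ℝ} {s : ℝ}
    {Q : Tensor d} {y : MultiIndex d → ℝ} (hy : ∀ i, 0 ≤ y i)
    (hφ : ∀ i, ∫⁻ k, ENNReal.ofReal (Real.exp (s * (φ k (Q i) - φ k (M i))))
      ∂(poissonMeasure (M i).toNNReal) ≤ ENNReal.ofReal (y i))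
    {S : Finset (MultiIndex d)} (hS : S.card = p) :
    ∫⁻ w, ENNReal.ofReal (Real.exp (s * ∑ i ∈ S, (φ (X w i) (Q i) - φ (X w i) (M i))))
      ∂(μ[|{w | Ω w = S}]) ≤ ENNReal.ofReal (∏ i ∈ S, y i) := by
  let f : MultiIndex d → ℕ → ℝ≥0∞ :=
    fun i k => ENNReal.ofReal (Real.exp (s * (φ k (Q i) - φ k (M i))))
  have hexp : ∀ w, ENNReal.ofReal
      (Real.exp (s * ∑ i ∈ S, (φ (X w i) (Q i) - φ (X w i) (M i))))
      = ∏ i : S, f i (X w i) := by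
    intro w
    rw [Finset.prod_coe_sort S (fun i => f i (X w i)), Finset.mul_sum, Real.exp_sum,
      ENNReal.ofReal_prod_of_nonneg fun i _ => (Real.exp_pos _).le]
  have hmeas : ∀ i : S, Measurable fun w => f i (X w i) := fun i =>
    (measurable_from_nat (f := f i)).comp (h.measurable_count i)
  have hind := (h.indep S hS).comp (fun i : S => f i) fun i => measurable_from_nat
  calc _ = ∫⁻ w, ∏ i : S, f i (X w i) ∂(μ[|{w | Ω w = S}]) := by simp_rw [hexp]
    _ = ∏ i : S, ∫⁻ w, f i (X w i) ∂(μ[|{w | Ω w = S}]) :=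
        lintegral_prod_eq_prod_lintegral_of_indepFun Finset.univ _ hind hmeas
    _ ≤ ∏ i : S, ENNReal.ofReal (y i) := by
        refine Finset.prod_le_prod' fun i _ => ?_
        refine le_trans (le_of_eq ?_) (hφ i)
        rw [← h.poisson S hS i i.2, lintegral_map measurable_from_nat (h.measurable_count i)]
    _ = ENNReal.ofReal (∏ i ∈ S, y i) := by
        rw [Finset.prod_coe_sort S (fun i => ENNReal.ofReal (y i)),
          ENNReal.ofReal_prod_of_nonneg fun i _ => hy i]

/-- The exponentially weighted sum of likelihood ratios over the candidates `𝒢`. -/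
noncomputable def ratioSum (φ : ℕ → ℝ → ℝ) (s : ℝ) (M : Tensor d) (c : Tensor d → ℝ)
    (𝒢 : Finset (Tensor d)) (S : Finset (MultiIndex d)) (x : MultiIndex d → ℕ) : ℝ≥0∞ :=
  ∑ Q ∈ 𝒢, ENNReal.ofReal (Real.exp (c Q)) *
    ENNReal.ofReal (Real.exp (s * ∑ i ∈ S, (φ (x i) (Q i) - φ (x i) (M i))))

/-- Maclaurin bounds the average over p-subsets by (1 - z̄)^p ≤ exp(-p z̄), with z̄ the mean of `z`.
This replaces independence between the sampled indices. -/
lemma exp_mul_mean_one_sub_pow_le {ι : Type*} [Fintype ι] [DecidableEq ι] {p : ℕ}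
    (hp : p ≤ Fintype.card ι) (hc : 0 < Fintype.card ι) {z : ι → ℝ} (hz : ∀ i, z i ≤ 1) :
    ((Fintype.card ι).choose p : ℝ)⁻¹ * (Real.exp (p * ((∑ i, z i) / Fintype.card ι)) *
      ∑ S ∈ Finset.powersetCard p Finset.univ, ∏ i ∈ S, (1 - z i)) ≤ 1 := by
  have hm := sum_powersetCard_prod_le p (y := fun i => 1 - z i) fun i => by linarith [hz i]
  set n : ℝ := ((Fintype.card ι : ℕ) : ℝ) with hn
  have hn0 : 0 < n := by rw [hn]; exact_mod_cast hc
  have hC : (0 : ℝ) < (Fintype.card ι).choose p := by exact_mod_cast Nat.choose_pos hp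
  have hsum : ∑ i, (1 - z i) = n * (1 - (∑ i, z i) / n) := by
    rw [Finset.sum_sub_distrib, mul_sub, mul_div_cancel₀ _ hn0.ne']
    simp [hn]
  have hmean : 0 ≤ 1 - (∑ i, z i) / n := by
    have : 0 ≤ ∑ i, (1 - z i) := Finset.sum_nonneg fun i _ => by linarith [hz i]
    rw [hsum] at this
    exact nonneg_of_mul_nonneg_right this hn0
  rw [hsum, mul_pow] at hm
  have hm' : ∑ S ∈ Finset.powersetCard p Finset.univ, ∏ i ∈ S, (1 - z i)
      ≤ (Fintype.card ι).choose p * (1 - (∑ i, z i) / n) ^ p := by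
    refine le_of_mul_le_mul_right ?_ (pow_pos hn0 p)
    linarith
  have hexp : (1 - (∑ i, z i) / n) ^ p ≤ Real.exp (-(p * ((∑ i, z i) / n))) := by
    rw [← mul_neg, Real.exp_nat_mul]
    refine pow_le_pow_left₀ hmean ?_ p
    linarith [Real.add_one_le_exp (-((∑ i, z i) / n))]
  rw [inv_mul_le_iff₀ hC, mul_one]
  calc _ ≤ Real.exp (p * ((∑ i, z i) / n)) *
        ((Fintype.card ι).choose p * Real.exp (-(p * ((∑ i, z i) / n)))) := by
        gcongr
        exact hm'.trans (by gcongr)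
    _ = (Fintype.card ι).choose p *
        (Real.exp (p * ((∑ i, z i) / n)) * Real.exp (-(p * ((∑ i, z i) / n)))) := by ring
    _ = _ := by rw [← Real.exp_add]; simp

lemma IsPoissonSample.le_card [IsProbabilityMeasure μ] (h : IsPoissonSample μ M p Ω X) :
    p ≤ Fintype.card (MultiIndex d) := by
  obtain ⟨w, hw⟩ := h.card_eq.exists
  rw [← hw]
  exact Finset.card_le_univ _

/-- The weights make each candidate's term have expectation at most 1, so the sum has expectation at
most |𝒢|, and Markov at level p|𝒢| leaves 1/p. Markov is applied on each event `Ω = S` separately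
and the pieces are summed. -/
lemma measure_le_ratioSum_le [IsProbabilityMeasure μ] (h : IsPoissonSample μ M p Ω X)
    (hp : 1 ≤ p) {φ : ℕ → ℝ → ℝ} {s γ : ℝ} {𝒢 : Finset (Tensor d)} (h𝒢 : 𝒢.Nonempty)
    (hγ : ∀ Q ∈ 𝒢, ∀ i, γ * (M i - Q i) ^ 2 ≤ 1)
    (hφ : ∀ Q ∈ 𝒢, ∀ i, ∫⁻ k, ENNReal.ofReal (Real.exp (s * (φ k (Q i) - φ k (M i))))
      ∂(poissonMeasure (M i).toNNReal) ≤ ENNReal.ofReal (1 - γ * (M i - Q i) ^ 2)) :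
    μ {w | ((p * 𝒢.card : ℕ) : ℝ≥0∞) ≤ ratioSum φ s M
      (fun Q => p * ((∑ i, γ * (M i - Q i) ^ 2) / Fintype.card (MultiIndex d))) 𝒢 (Ω w) (X w)}
      ≤ (p : ℝ≥0∞)⁻¹ := by
  classical
  set c : Tensor d → ℝ :=
    fun Q => p * ((∑ i, γ * (M i - Q i) ^ 2) / Fintype.card (MultiIndex d)) with hc
  set a : ℝ≥0∞ := ((p * 𝒢.card : ℕ) : ℝ≥0∞) with ha
  have hpc := h.le_card
  have ha0 : a ≠ 0 := by
    rw [ha, Nat.cast_ne_zero]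
    exact (Nat.mul_pos hp h𝒢.card_pos).ne'
  have hat : a ≠ ⊤ := ENNReal.natCast_ne_top _
  set C : ℝ≥0∞ := ((Nat.choose (Fintype.card (MultiIndex d)) p : ℕ) : ℝ≥0∞)⁻¹ with hC
  have hcond : ∀ S ∈ Finset.powersetCard p (Finset.univ : Finset (MultiIndex d)),
      μ ({w | Ω w = S} ∩ {w | a ≤ ratioSum φ s M c 𝒢 S (X w)})
        ≤ C * ((∑ Q ∈ 𝒢, ENNReal.ofReal (Real.exp (c Q)) *
          ENNReal.ofReal (∏ i ∈ S, (1 - γ * (M i - Q i) ^ 2))) / a) := by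
    intro S hS
    have hS' := (Finset.mem_powersetCard.1 hS).2
    rw [← cond_mul_eq_inter (h.measurableSet_eq S), h.uniform S hS', mul_comm]
    refine mul_le_mul_right ?_ _
    have hterm : ∀ Q : Tensor d, Measurable fun w => ENNReal.ofReal
        (Real.exp (s * ∑ i ∈ S, (φ (X w i) (Q i) - φ (X w i) (M i)))) := by
      intro Q
      refine ENNReal.measurable_ofReal.comp (Real.measurable_exp.comp (Measurable.const_mul ?_ s))
      refine Finset.measurable_sum S fun i _ => ?_
      exact (measurable_from_nat (f := fun k => φ k (Q i) - φ k (M i))).comp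
        (h.measurable_count i)
    have hmeas : Measurable fun w => ratioSum φ s M c 𝒢 S (X w) :=
      Finset.measurable_sum 𝒢 fun Q _ => (hterm Q).const_mul _
    refine (meas_ge_le_lintegral_div hmeas.aemeasurable ha0 hat).trans ?_
    refine ENNReal.div_le_div_right ?_ a
    unfold ratioSum
    rw [lintegral_finsetSum 𝒢 fun Q _ => (hterm Q).const_mul _]
    refine Finset.sum_le_sum fun Q hQ => ?_
    rw [lintegral_const_mul _ (hterm Q)]
    refine mul_le_mul_right ?_ _
    exact lintegral_cond_exp_sum_le h (fun i => by linarith [hγ Q hQ i]) (hφ Q hQ) hS'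
  have hsub : {w | a ≤ ratioSum φ s M c 𝒢 (Ω w) (X w)} ⊆ {w | ¬ (Ω w).card = p} ∪
      ⋃ S ∈ Finset.powersetCard p (Finset.univ : Finset (MultiIndex d)),
        ({w | Ω w = S} ∩ {w | a ≤ ratioSum φ s M c 𝒢 S (X w)}) := by
    intro w hw
    by_cases hwp : (Ω w).card = p
    · refine Or.inr (Set.mem_iUnion₂.2 ⟨Ω w, ?_, rfl, hw⟩)
      simp [Finset.mem_powersetCard, hwp]
    · exact Or.inl hwp
  have hCr : C = ENNReal.ofReal
      (((Fintype.card (MultiIndex d)).choose p : ℝ)⁻¹) := by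
    rw [hC, ENNReal.ofReal_inv_of_pos (by exact_mod_cast Nat.choose_pos hpc),
      ENNReal.ofReal_natCast]
  have hQ : ∀ Q ∈ 𝒢, ∑ S ∈ Finset.powersetCard p (Finset.univ : Finset (MultiIndex d)),
      C * (ENNReal.ofReal (Real.exp (c Q)) *
        ENNReal.ofReal (∏ i ∈ S, (1 - γ * (M i - Q i) ^ 2))) ≤ 1 := by
    intro Q hQ
    have hpos : ∀ S : Finset (MultiIndex d), 0 ≤ ∏ i ∈ S, (1 - γ * (M i - Q i) ^ 2) :=
      fun S => Finset.prod_nonneg fun i _ => by linarith [hγ Q hQ i]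
    rw [← Finset.mul_sum, ← Finset.mul_sum, ← ENNReal.ofReal_sum_of_nonneg fun S _ => hpos S,
      ← ENNReal.ofReal_mul (Real.exp_pos _).le, hCr, ← ENNReal.ofReal_mul (by positivity),
      ← ENNReal.ofReal_one]
    exact ENNReal.ofReal_le_ofReal
      (exp_mul_mean_one_sub_pow_le hpc (hp.trans hpc) (hγ Q hQ))
  calc _ ≤ μ {w | ¬ (Ω w).card = p} + μ (⋃ S ∈ Finset.powersetCard p
        (Finset.univ : Finset (MultiIndex d)),
          ({w | Ω w = S} ∩ {w | a ≤ ratioSum φ s M c 𝒢 S (X w)})) :=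
        (measure_mono hsub).trans (measure_union_le _ _)
    _ ≤ 0 + ∑ S ∈ Finset.powersetCard p (Finset.univ : Finset (MultiIndex d)),
        C * ((∑ Q ∈ 𝒢, ENNReal.ofReal (Real.exp (c Q)) *
          ENNReal.ofReal (∏ i ∈ S, (1 - γ * (M i - Q i) ^ 2))) / a) := by
        refine add_le_add (le_of_eq (ae_iff.1 h.card_eq)) ?_
        exact (measure_biUnion_finset_le _ _).trans (Finset.sum_le_sum hcond)
    _ = (∑ Q ∈ 𝒢, ∑ S ∈ Finset.powersetCard p (Finset.univ : Finset (MultiIndex d)),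
        C * (ENNReal.ofReal (Real.exp (c Q)) *
          ENNReal.ofReal (∏ i ∈ S, (1 - γ * (M i - Q i) ^ 2)))) / a := by
        rw [zero_add, Finset.sum_comm]
        simp_rw [div_eq_mul_inv, ← mul_assoc, ← Finset.sum_mul, Finset.mul_sum]
        simp_rw [mul_assoc]
    _ ≤ (𝒢.card : ℝ≥0∞) / a := by
        refine ENNReal.div_le_div_right ((Finset.sum_le_sum hQ).trans ?_) a
        simp
    _ = (p : ℝ≥0∞)⁻¹ := by
        have h0 : (𝒢.card : ℝ≥0∞) ≠ 0 := by exact_mod_cast h𝒢.card_pos.ne'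
        rw [ha, Nat.cast_mul, mul_comm, ENNReal.div_eq_inv_mul,
          ENNReal.mul_inv (Or.inl h0) (Or.inl (ENNReal.natCast_ne_top _)), mul_right_comm,
          ENNReal.inv_mul_cancel h0 (ENNReal.natCast_ne_top _), one_mul]

end Deviation

/-! ### From grid candidates to the whole search space. -/

section UniformBound

open scoped ENNReal

variable {N : ℕ} {d : Fin N → ℕ}

lemma card_mul_sq_le_sqNorm {β : ℝ} (hβ : 0 < β) {M : Tensor d} (hM : ∀ i, β ≤ M i) :
    Fintype.card (MultiIndex d) * β ^ 2 ≤ sqNorm M := by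
  have h : ∑ _i : MultiIndex d, β ^ 2 ≤ sqNorm M :=
    Finset.sum_le_sum fun i _ => pow_le_pow_left₀ hβ.le (hM i) 2
  simpa using h

lemma relErr_le_mean_div {β : ℝ} (hβ : 0 < β) [Nonempty (MultiIndex d)] {M T : Tensor d}
    (hM : ∀ i, β ≤ M i) :
    relErr M T ≤ (∑ i, (M i - T i) ^ 2) / Fintype.card (MultiIndex d) / β ^ 2 := by
  have hn : (0 : ℝ) < Fintype.card (MultiIndex d) := by exact_mod_cast Fintype.card_pos
  rw [div_div]
  exact div_le_div_of_nonneg_left (Finset.sum_nonneg fun i _ => sq_nonneg _) (by positivity)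
    (card_mul_sq_le_sqNorm hβ hM)

lemma relErr_le_ratio_sq [Nonempty (MultiIndex d)] {R : ℕ} {α β : ℝ} (hβ : 0 < β)
    {M T : Tensor d} (hM : M ∈ searchSpace d R β α) (hT : T ∈ searchSpace d R β α) :
    relErr M T ≤ α ^ 2 / β ^ 2 := by
  refine (relErr_le_mean_div hβ fun i => (hM.1 i).1).trans ?_
  refine div_le_div_of_nonneg_right ?_ (by positivity)
  have hn : (0 : ℝ) < Fintype.card (MultiIndex d) := by exact_mod_cast Fintype.card_pos
  rw [div_le_iff₀ hn]
  have h : ∑ i, (M i - T i) ^ 2 ≤ ∑ _i : MultiIndex d, α ^ 2 := by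
    refine Finset.sum_le_sum fun i _ => sq_le_sq' ?_ ?_ <;>
      linarith [(hM.1 i).1, (hM.1 i).2, (hT.1 i).1, (hT.1 i).2]
  simpa [mul_comm] using h

/-- Only subadditivity is used, so the good event, a condition over uncountably many tensors, need
not be measurable. -/
lemma one_sub_inv_le_measureReal {W : Type*} [MeasurableSpace W] {μ : Measure W}
    [IsProbabilityMeasure μ] {p : ℕ} (hp : 1 ≤ p) {B E : Set W} (hB : μ B ≤ (p : ℝ≥0∞)⁻¹)
    (h : ∀ w, w ∉ B → w ∈ E) : 1 - (p : ℝ)⁻¹ ≤ μ.real E := by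
  have h1 : μ.real B ≤ (p : ℝ)⁻¹ := by
    have := ENNReal.toReal_mono (by simpa using (by omega : p ≠ 0)) hB
    simpa [Measure.real] using this
  have h2 : (1 : ℝ) ≤ μ.real B + μ.real E := by
    rw [← probReal_univ (μ := μ)]
    refine (measureReal_mono (fun w _ => ?_)).trans (measureReal_union_le B E)
    by_cases hw : w ∈ B
    · exact Or.inl hw
    · exact Or.inr (h w hw)
  linarith

/-- With probability at least `1 - 1 / p`, every tensor in the search space whose criterion is at
least that of `M` is close to `M`. -/
lemma one_sub_inv_le_measureReal_relErr_le (hN : 1 ≤ N) (hd : ∀ n, 1 ≤ d n) {α β : ℝ}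
    (hβ : 0 < β) (hβα : β ≤ α) {R : ℕ} (hR : 1 ≤ R) {M : Tensor d}
    (hM : M ∈ searchSpace d R β α) {p : ℕ} (hp : 1 ≤ p) {W : Type*} [MeasurableSpace W]
    {μ : Measure W} [IsProbabilityMeasure μ] {Ω : W → Finset (MultiIndex d)}
    {X : W → MultiIndex d → ℕ} (h : IsPoissonSample μ M p Ω X) {φ : ℕ → ℝ → ℝ} {γ Λ : ℝ}
    (hγ : 0 < γ) (hγα : γ * (4 * α ^ 2) ≤ 1) (hΛ : 0 ≤ Λ)
    (hmono : ∀ k t u, β ≤ t → t ≤ u → φ k t ≤ φ k u + Λ * (u - t))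
    (hφ : ∀ m t, β ≤ m → β ≤ t → m ≤ α → t ≤ 2 * α →
      ∫⁻ k, ENNReal.ofReal (Real.exp (chernoffExp α * (φ k t - φ k m)))
        ∂(poissonMeasure m.toNNReal) ≤ ENNReal.ofReal (1 - γ * (m - t) ^ 2)) :
    1 - (p : ℝ)⁻¹ ≤ μ.real {w | ∀ T ∈ searchSpace d R β α,
      ∑ i ∈ Ω w, φ (X w i) (M i) ≤ ∑ i ∈ Ω w, φ (X w i) (T i) →
      relErr M T ≤ 2 / β ^ 2 * ((Real.log p + (R * ∑ n, d n : ℕ) * Real.log ((R * N * p + 1 : ℕ))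
        + Λ / 2) / (γ * p) + α ^ 2 / p ^ 2)} := by
  classical
  have hα : 0 < α := hβ.trans_le hβα
  have : Nonempty (MultiIndex d) := ⟨fun n => ⟨0, hd n⟩⟩
  have hn : (0 : ℝ) < Fintype.card (MultiIndex d) := by exact_mod_cast Fintype.card_pos
  -- This mesh makes the entrywise rounding error α/p, hence a total of α over the p observations.
  set K := R * N * p with hK
  have hK1 : 1 ≤ K := Nat.mul_pos (Nat.mul_pos hR hN) hp
  have hp0 : (0 : ℝ) < p := by exact_mod_cast hp
  have hδ : α * (R * N / K) = α / p := by
    have hR0 : (R : ℝ) ≠ 0 := by exact_mod_cast (by omega : R ≠ 0)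
    have hN0 : (N : ℝ) ≠ 0 := by exact_mod_cast (by omega : N ≠ 0)
    rw [hK]
    push_cast
    field_simp
  have hδα : α / p ≤ α := div_le_self hα.le (by exact_mod_cast hp)
  set grid : Finset (Tensor d) := (Finset.univ.image fun
    g : Fin R → ∀ n : Fin N, Fin (d n) → Fin (K + 1) => gridTensor α K g) with hgrid
  set 𝒢 := grid.filter fun Q => ∀ i, β ≤ Q i ∧ Q i ≤ 2 * α with h𝒢
  have hround : ∀ T ∈ searchSpace d R β α, ∃ Q ∈ 𝒢, ∀ i, T i ≤ Q i ∧ Q i ≤ T i + α / p := by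
    intro T hT
    obtain ⟨g, hg⟩ := exists_gridTensor_ge hN hd hβ hβα hK1 hT
    rw [hδ] at hg
    refine ⟨gridTensor α K g, ?_, hg⟩
    rw [h𝒢, Finset.mem_filter, hgrid]
    refine ⟨Finset.mem_image_of_mem _ (Finset.mem_univ g), fun i => ⟨?_, ?_⟩⟩
    · exact (hT.1 i).1.trans (hg i).1
    · linarith [(hg i).2, (hT.1 i).2]
  have hne : 𝒢.Nonempty := by
    obtain ⟨Q, hQ, -⟩ := hround M hM
    exact ⟨Q, hQ⟩
  have hbox : ∀ Q ∈ 𝒢, ∀ i, β ≤ Q i ∧ Q i ≤ 2 * α := fun Q hQ => (Finset.mem_filter.1 hQ).2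
  have hcard : 𝒢.card ≤ (K + 1) ^ (R * ∑ n, d n) := by
    rw [← card_grid]
    exact (Finset.card_filter_le _ _).trans Finset.card_image_le
  have hbad := measure_le_ratioSum_le h hp hne (φ := φ) (s := chernoffExp α) (γ := γ)
    (fun Q hQ i => by
      refine le_trans (mul_le_mul_of_nonneg_left ?_ hγ.le) hγα
      have := hbox Q hQ i
      have := hM.1 i
      nlinarith)
    (fun Q hQ i => hφ _ _ (hM.1 i).1 (hbox Q hQ i).1 (hM.1 i).2 (hbox Q hQ i).2)
  set c : Tensor d → ℝ :=
    fun Q => p * ((∑ i, γ * (M i - Q i) ^ 2) / Fintype.card (MultiIndex d)) with hc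
  refine one_sub_inv_le_measureReal hp
    (B := {w | ¬ (Ω w).card = p} ∪ {w | ((p * 𝒢.card : ℕ) : ℝ≥0∞) ≤
      ratioSum φ (chernoffExp α) M c 𝒢 (Ω w) (X w)}) ?_ fun w hw T hT hle => ?_
  · refine (measure_union_le _ _).trans ?_
    rw [ae_iff.1 h.card_eq, zero_add]
    exact hbad
  rw [Set.mem_union, not_or] at hw
  have hwp : (Ω w).card = p := not_not.1 hw.1
  have hsmall : ratioSum φ (chernoffExp α) M c 𝒢 (Ω w) (X w) < ((p * 𝒢.card : ℕ) : ℝ≥0∞) :=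
    not_le.1 hw.2
  obtain ⟨Q, hQ, hTQ⟩ := hround T hT
  have hterm : ENNReal.ofReal (Real.exp (c Q)) * ENNReal.ofReal (Real.exp (chernoffExp α *
      ∑ i ∈ Ω w, (φ (X w i) (Q i) - φ (X w i) (M i)))) < ((p * 𝒢.card : ℕ) : ℝ≥0∞) :=
    lt_of_le_of_lt (Finset.single_le_sum (f := fun Q => ENNReal.ofReal (Real.exp (c Q)) *
      ENNReal.ofReal (Real.exp (chernoffExp α *
        ∑ i ∈ Ω w, (φ (X w i) (Q i) - φ (X w i) (M i))))) (fun _ _ => zero_le) hQ) hsmall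
  rw [← ENNReal.ofReal_mul (Real.exp_pos _).le, ← Real.exp_add, ← ENNReal.ofReal_natCast,
    ENNReal.ofReal_lt_ofReal_iff_of_nonneg (Real.exp_pos _).le] at hterm
  have h𝒢0 : (0 : ℝ) < 𝒢.card := by exact_mod_cast hne.card_pos
  have hlog := Real.log_le_log (Real.exp_pos _) hterm.le
  rw [Real.log_exp, Nat.cast_mul, Real.log_mul hp0.ne' h𝒢0.ne'] at hlog
  have hlogcard : Real.log 𝒢.card ≤ (R * ∑ n, d n : ℕ) * Real.log ((K + 1 : ℕ)) := by
    rw [← Real.log_pow]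
    exact Real.log_le_log h𝒢0 (by exact_mod_cast hcard)
  have hs0 : 0 ≤ chernoffExp α := by unfold chernoffExp; positivity
  have hsα : chernoffExp α * α ≤ 1 / 2 := by
    unfold chernoffExp
    rw [div_mul_eq_mul_div, div_le_div_iff₀ (by positivity) (by norm_num)]
    linarith
  -- `T` does at least as well as `M`, and its rounding `Q` loses at most Λα/p per observation.
  -- After multiplication by s the total loss is at most Λ/2, because sα ≤ 1/2.
  have hloss : -(Λ * α) ≤ ∑ i ∈ Ω w, (φ (X w i) (Q i) - φ (X w i) (M i)) := by
    have h1 : ∑ i ∈ Ω w, (φ (X w i) (T i) - Λ * (α / p)) ≤ ∑ i ∈ Ω w, φ (X w i) (Q i) := by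
      refine Finset.sum_le_sum fun i _ => ?_
      have h2 := hmono (X w i) _ _ (hT.1 i).1 (hTQ i).1
      have h3 := mul_le_mul_of_nonneg_left
        (show Q i - T i ≤ α / p by linarith [(hTQ i).2]) hΛ
      linarith
    rw [Finset.sum_sub_distrib, Finset.sum_const, hwp, nsmul_eq_mul] at h1
    have h4 : (p : ℝ) * (Λ * (α / p)) = Λ * α := by field_simp
    rw [Finset.sum_sub_distrib]
    linarith
  have hloss' : -(Λ / 2) ≤ chernoffExp α *
      ∑ i ∈ Ω w, (φ (X w i) (Q i) - φ (X w i) (M i)) := by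
    have h1 := mul_le_mul_of_nonneg_left hloss hs0
    have h2 := mul_le_mul_of_nonneg_left hsα hΛ
    linarith
  set L := Real.log p + (R * ∑ n, d n : ℕ) * Real.log ((K + 1 : ℕ)) + Λ / 2 with hL
  have hcL : c Q ≤ L := by linarith
  have hmeanQ : (∑ i, (M i - Q i) ^ 2) / Fintype.card (MultiIndex d) ≤ L / (γ * p) := by
    rw [le_div_iff₀ (by positivity)]
    refine le_trans (le_of_eq ?_) hcL
    simp only [hc, ← Finset.mul_sum]
    ring
  have hmeanT : (∑ i, (M i - T i) ^ 2) / Fintype.card (MultiIndex d)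
      ≤ 2 * ((∑ i, (M i - Q i) ^ 2) / Fintype.card (MultiIndex d) + α ^ 2 / p ^ 2) := by
    have h1 : ∑ i, (M i - T i) ^ 2 ≤ ∑ i, (2 * (M i - Q i) ^ 2 + 2 * (α / p) ^ 2) := by
      refine Finset.sum_le_sum fun i _ => ?_
      have h2 : (Q i - T i) ^ 2 ≤ (α / p) ^ 2 :=
        pow_le_pow_left₀ (by linarith [(hTQ i).1]) (by linarith [(hTQ i).2]) 2
      nlinarith [sq_nonneg ((M i - Q i) - (Q i - T i))]
    rw [div_le_iff₀ hn]
    refine h1.trans (le_of_eq ?_)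
    rw [Finset.sum_add_distrib, ← Finset.mul_sum, Finset.sum_const, Finset.card_univ,
      nsmul_eq_mul]
    field_simp
  refine (relErr_le_mean_div hβ fun i => (hM.1 i).1).trans ?_
  rw [div_le_iff₀ (by positivity)]
  have h2 : 2 / β ^ 2 * (L / (γ * p) + α ^ 2 / p ^ 2) * β ^ 2
      = 2 * (L / (γ * p) + α ^ 2 / p ^ 2) := by field_simp
  rw [h2]
  linarith

end UniformBound

/-! ### Entropy of the grid, and bounds on the constants in β. -/

section Constants

/-- The amplification factor enters the proof only through this lower bound. -/
lemma one_add_div_le_kappa {β : ℝ} (hβ : 0 < β) : (1 + β) / (2 * β) ≤ kappa β := by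
  have h1 : 0 < Real.exp β - β - 1 := by linarith [Real.add_one_lt_exp hβ.ne']
  unfold kappa
  rw [div_le_div_iff₀ (by positivity) (by positivity)]
  have h2 := Real.add_one_le_exp (-β)
  have h3 : Real.exp β * Real.exp (-β) = 1 := by rw [← Real.exp_add]; simp
  have h4 : Real.exp β - 1 ≤ β * Real.exp β := by
    nlinarith [mul_le_mul_of_nonneg_left h2 (Real.exp_pos β).le]
  nlinarith [mul_le_mul_of_nonneg_left h4 hβ.le, exp_sub_one_pos hβ,
    mul_pos hβ (exp_sub_one_pos hβ)]

lemma sq_div_le_exp_sub_mul_exp_neg {β : ℝ} (hβ : 0 < β) :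
    β ^ 2 / (2 * (1 + β) ^ 2) ≤ (Real.exp β - 1 - β) * Real.exp (-β) := by
  have h1 := Real.quadratic_le_exp_of_nonneg hβ.le
  have h3 : Real.exp β * Real.exp (-β) = 1 := by rw [← Real.exp_add]; simp
  have h4 : (Real.exp β - 1 - β) * Real.exp (-β) = (Real.exp β - 1 - β) / Real.exp β := by
    rw [Real.exp_neg, div_eq_mul_inv]
  rw [h4, div_le_div_iff₀ (by positivity) (Real.exp_pos _)]
  nlinarith [mul_le_mul_of_nonneg_left h1 (by nlinarith : 0 ≤ 2 * (1 + β) ^ 2 - β ^ 2)]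

/-- The constant in the metric entropy bound for the search space. -/
noncomputable def entropyConst (N : ℕ) : ℝ := N + N * (Real.log (N + 1) + 2 * N) + 1

lemma one_le_entropyConst (N : ℕ) : 1 ≤ entropyConst N := by
  have : 0 ≤ Real.log ((N : ℝ) + 1) := Real.log_nonneg (by linarith [Nat.cast_nonneg (α := ℝ) N])
  unfold entropyConst
  have : 0 ≤ (N : ℝ) + N * (Real.log (N + 1) + 2 * N) := by positivity
  linarith

lemma log_add_entropy_le {N R I p D : ℕ} (hR : 1 ≤ R) (hI : 2 ≤ I) (hp : 1 ≤ p)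
    (hpI : p ≤ I ^ N) (hRp : R ≤ p) (hD : D ≤ N * I) {Λ : ℝ} (hΛ : 1 ≤ Λ) :
    Real.log p + (R * D : ℕ) * Real.log ((R * N * p + 1 : ℕ)) + Λ / 2
      ≤ entropyConst N * Λ * (R * I * Real.logb 2 I) := by
  have hR' : (1 : ℝ) ≤ R := by exact_mod_cast hR
  have hI' : (2 : ℝ) ≤ I := by exact_mod_cast hI
  have hp' : (1 : ℝ) ≤ p := by exact_mod_cast hp
  have hRp' : (R : ℝ) ≤ p := by exact_mod_cast hRp
  have hD' : (D : ℝ) ≤ N * I := by exact_mod_cast hD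
  have hN' : (0 : ℝ) ≤ N := Nat.cast_nonneg N
  set l := Real.logb 2 I with hl
  have hl1 : 1 ≤ l := by
    rw [hl, Real.le_logb_iff_rpow_le (by norm_num) (by linarith)]
    simpa using hI'
  have hlog : Real.log I ≤ l := by
    rw [hl, Real.logb, le_div_iff₀ (Real.log_pos (by norm_num))]
    have := Real.log_two_lt_d9
    have h0 : 0 ≤ Real.log I := Real.log_nonneg (by linarith)
    nlinarith
  have hlogp : Real.log p ≤ N * l := by
    calc Real.log p ≤ Real.log ((I : ℝ) ^ N) :=
          Real.log_le_log (by linarith) (by exact_mod_cast hpI)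
      _ = N * Real.log I := Real.log_pow _ _
      _ ≤ _ := by gcongr
  have hlogK : Real.log ((R * N * p + 1 : ℕ)) ≤ (Real.log (N + 1) + 2 * N) * l := by
    have h0 : 0 ≤ Real.log ((N : ℝ) + 1) := Real.log_nonneg (by linarith)
    calc Real.log ((R * N * p + 1 : ℕ)) ≤ Real.log (((N : ℝ) + 1) * (p : ℝ) ^ 2) := by
          refine Real.log_le_log (by positivity) ?_
          push_cast
          -- R ≤ p removes the rank from the logarithm, so that only log p ≤ N log I remains.
          have h1 : (R : ℝ) * N * p ≤ p * N * p := by gcongr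
          nlinarith
      _ = Real.log (N + 1) + 2 * Real.log p := by
          rw [Real.log_mul (by positivity) (by positivity), Real.log_pow]
          norm_num
      _ ≤ Real.log (N + 1) * l + 2 * (N * l) := by
          have := le_mul_of_one_le_right h0 hl1
          linarith
      _ = _ := by ring
  have hlN : 0 ≤ Real.log ((N : ℝ) + 1) := Real.log_nonneg (by linarith)
  have hX : l ≤ R * I * l := by
    have : (1 : ℝ) ≤ R * I := by nlinarith
    nlinarith
  calc _ ≤ N * l + R * (N * I) * ((Real.log (N + 1) + 2 * N) * l) + Λ / 2 := by
        rw [Nat.cast_mul R D]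
        gcongr
    _ ≤ N * (R * I * l) + N * (Real.log (N + 1) + 2 * N) * (R * I * l) + Λ * (R * I * l) := by
        have h1 : (N : ℝ) * l ≤ N * (R * I * l) := by gcongr
        have h2 : Λ / 2 ≤ Λ * (R * I * l) := by nlinarith
        linarith
    _ ≤ N * (Λ * (R * I * l)) + N * (Real.log (N + 1) + 2 * N) * (Λ * (R * I * l))
        + Λ * (R * I * l) := by
        have h1 : R * I * l ≤ Λ * (R * I * l) := le_mul_of_one_le_left (by positivity) hΛ
        gcongr
    _ = _ := by unfold entropyConst; ring

/-- The rate `R I^{1/2} log₂ I / p^{1/2}`. -/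
noncomputable def rate (R I p : ℕ) : ℝ := (R : ℝ) * Real.sqrt I * Real.logb 2 I / Real.sqrt p

lemma rate_sq (R I p : ℕ) :
    rate R I p ^ 2 = (R : ℝ) ^ 2 * I * Real.logb 2 I ^ 2 / p := by
  unfold rate
  rw [div_pow, mul_pow, mul_pow, Real.sq_sqrt (Nat.cast_nonneg _), Real.sq_sqrt (Nat.cast_nonneg _)]

lemma one_le_logb_two {I : ℕ} (hI : 2 ≤ I) : 1 ≤ Real.logb 2 I := by
  have hI' : (2 : ℝ) ≤ I := by exact_mod_cast hI
  rw [Real.le_logb_iff_rpow_le (by norm_num) (by linarith)]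
  simpa using hI'

lemma div_le_rate_sq {R I p : ℕ} (hR : 1 ≤ R) (hI : 2 ≤ I) :
    (R * I * Real.logb 2 I) / p ≤ rate R I p ^ 2 := by
  have hR' : (1 : ℝ) ≤ R := by exact_mod_cast hR
  have hl := one_le_logb_two hI
  rw [rate_sq]
  refine div_le_div_of_nonneg_right ?_ (Nat.cast_nonneg p)
  have : (1 : ℝ) ≤ R * Real.logb 2 I := one_le_mul_of_one_le_of_one_le hR' hl
  calc (R : ℝ) * I * Real.logb 2 I ≤ R * I * Real.logb 2 I * (R * Real.logb 2 I) :=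
        le_mul_of_one_le_right (by positivity) this
    _ = _ := by ring

lemma le_of_rate_lt_one {R I p : ℕ} (hR : 1 ≤ R) (hI : 2 ≤ I) (hp : 1 ≤ p)
    (h : rate R I p < 1) : R ≤ p := by
  have hl := one_le_logb_two hI
  have hR' : (1 : ℝ) ≤ R := by exact_mod_cast hR
  have hI' : (2 : ℝ) ≤ I := by exact_mod_cast hI
  have hp' : (0 : ℝ) < p := by exact_mod_cast hp
  have h0 : 0 ≤ rate R I p := by unfold rate; positivity
  have h1 := (div_le_rate_sq (p := p) hR hI).trans (pow_le_one₀ h0 h.le)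
  rw [div_le_one hp'] at h1
  have h2 : (R : ℝ) ≤ R * I * Real.logb 2 I := by
    rw [mul_assoc]
    exact le_mul_of_one_le_right (by linarith) (by nlinarith)
  exact_mod_cast h2.trans h1

/-- The deviation bound in terms of the squared rate. -/
lemma deviation_le_rate_sq {N R I p D : ℕ} (hR : 1 ≤ R) (hI : 2 ≤ I) (hp : 1 ≤ p)
    (hpI : p ≤ I ^ N) (hrate : rate R I p < 1) (hD : D ≤ N * I) {α β γ Λ : ℝ} (hβ : 0 < β)
    (hγ : 0 < γ) (hΛ : 1 ≤ Λ) :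
    2 / β ^ 2 * ((Real.log p + (R * D : ℕ) * Real.log ((R * N * p + 1 : ℕ)) + Λ / 2) / (γ * p)
        + α ^ 2 / p ^ 2)
      ≤ 2 / β ^ 2 * (entropyConst N * (Λ / γ + α ^ 2)) * rate R I p ^ 2 := by
  have hp' : (1 : ℝ) ≤ p := by exact_mod_cast hp
  have hR' : (1 : ℝ) ≤ R := by exact_mod_cast hR
  have hI' : (2 : ℝ) ≤ I := by exact_mod_cast hI
  have hl := one_le_logb_two hI
  have hX : (1 : ℝ) ≤ R * I * Real.logb 2 I :=
    one_le_mul_of_one_le_of_one_le (one_le_mul_of_one_le_of_one_le hR' (by linarith)) hl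
  have hB := one_le_entropyConst N
  have hr := div_le_rate_sq (p := p) hR hI
  rw [mul_assoc (2 / β ^ 2)]
  refine mul_le_mul_of_nonneg_left ?_ (by positivity)
  have h1 : (Real.log p + (R * D : ℕ) * Real.log ((R * N * p + 1 : ℕ)) + Λ / 2) / (γ * p)
      ≤ entropyConst N * (Λ / γ) * rate R I p ^ 2 := by
    calc _ ≤ entropyConst N * Λ * (R * I * Real.logb 2 I) / (γ * p) := by
          gcongr
          exact log_add_entropy_le hR hI hp hpI (le_of_rate_lt_one hR hI hp hrate) hD hΛ
      _ = entropyConst N * (Λ / γ) * ((R * I * Real.logb 2 I) / p) := by field_simp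
      _ ≤ _ := by gcongr
  have h2 : α ^ 2 / p ^ 2 ≤ entropyConst N * α ^ 2 * rate R I p ^ 2 := by
    have h3 : 1 / (p : ℝ) ^ 2 ≤ rate R I p ^ 2 := by
      refine le_trans ?_ hr
      rw [div_le_div_iff₀ (by positivity) (by positivity)]
      nlinarith
    calc α ^ 2 / p ^ 2 = 1 * α ^ 2 * (1 / (p : ℝ) ^ 2) := by ring
      _ ≤ _ := by gcongr
  linarith

end Constants

/-! ### Conversion of the fast rate into the stated error levels. -/

section Levels

lemma ratio_sq_le_errLevel {C α β : ℝ} {R I p : ℕ} (hC : 1 ≤ C) (hβ : 0 < β) (hβα : β ≤ α)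
    (h : 1 ≤ rate R I p) : α ^ 2 / β ^ 2 ≤ errLevel C α β R I p := by
  have hα : 0 < α := hβ.trans_le hβα
  have h1 : α ^ 2 / β ^ 2 ≤ α * (α + 1) ^ 2 / β ^ 3 := by
    rw [div_le_div_iff₀ (by positivity) (by positivity)]
    have h2 : α * β ≤ (α + 1) ^ 2 := by nlinarith
    calc α ^ 2 * β ^ 3 = α * β ^ 2 * (α * β) := by ring
      _ ≤ α * β ^ 2 * (α + 1) ^ 2 := by gcongr
      _ = _ := by ring
  have h3 : 0 ≤ α * (α + 1) ^ 2 / β ^ 3 := by positivity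
  calc α ^ 2 / β ^ 2 ≤ 1 * (α * (α + 1) ^ 2 / β ^ 3) * 1 := by linarith
    _ ≤ C * (α * (α + 1) ^ 2 / β ^ 3) * rate R I p := by gcongr

/-- A rate below 1 dominates its square. The constant is 66 = 2 · 32 + 2, from 1/γ = 32α(1+α) and
the rounding term α². -/
lemma le_errLevel_of_le_rate_sq {B α β r : ℝ} {R I p : ℕ} (hB : 1 ≤ B) (hβ : 0 < β)
    (hβα : β ≤ α) (h0 : 0 ≤ rate R I p) (h1 : rate R I p < 1)
    (hr : r ≤ 2 / β ^ 2 * (B * (1 / (1 / (32 * α * (1 + α))) + α ^ 2)) * rate R I p ^ 2) :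
    r ≤ errLevel (66 * B) α β R I p := by
  have hα : 0 < α := hβ.trans_le hβα
  refine hr.trans ?_
  have h2 : 2 / β ^ 2 * (B * (1 / (1 / (32 * α * (1 + α))) + α ^ 2))
      ≤ 66 * B * (α * (α + 1) ^ 2 / β ^ 3) := by
    have h4 : (64 * α * (1 + α) + 2 * α ^ 2) * β ≤ 66 * (α * (α + 1) ^ 2) := by
      calc (64 * α * (1 + α) + 2 * α ^ 2) * β ≤ (66 * α * (1 + α)) * (1 + α) :=
            mul_le_mul (by nlinarith) (by linarith) hβ.le (by positivity)
        _ = _ := by ring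
    calc _ = B * ((64 * α * (1 + α) + 2 * α ^ 2) * β) / β ^ 3 := by field_simp; ring
      _ ≤ B * (66 * (α * (α + 1) ^ 2)) / β ^ 3 :=
          div_le_div_of_nonneg_right (mul_le_mul_of_nonneg_left h4 (by linarith)) (by positivity)
      _ = _ := by ring
  have h3 : rate R I p ^ 2 ≤ rate R I p := by nlinarith
  exact mul_le_mul h2 h3 (by positivity) (by positivity)

/-- The fast bound alone carries β⁻⁵, too singular for small β. Multiplying it by the trivial bound
α²/β² bounds r², and taking the root gives a single power of the rate with a singularity that fits
under the target. -/
lemma le_kappa_mul_errLevel_of_le_rate_sq {B α β r : ℝ} {R I p : ℕ} (hB : 1 ≤ B) (hβ : 0 < β)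
    (hβα : β ≤ α) (h0 : 0 ≤ rate R I p) (hr0 : 0 ≤ r) (hrat : r ≤ α ^ 2 / β ^ 2)
    (hr : r ≤ 2 / β ^ 2 * (B * ((1 + 1 / β) /
      ((Real.exp β - 1 - β) * Real.exp (-β) / (32 * α * (1 + α))) + α ^ 2)) * rate R I p ^ 2) :
    r ≤ kappa β * errLevel (66 * B) α β R I p := by
  have hα : 0 < α := hβ.trans_le hβα
  set τ := (Real.exp β - 1 - β) * Real.exp (-β) with hτ
  have hτ1 := sq_div_le_exp_sub_mul_exp_neg hβ
  rw [← hτ] at hτ1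
  have hτ0 : 0 < τ := lt_of_lt_of_le (by positivity) hτ1
  have hinv : (1 + 1 / β) / (τ / (32 * α * (1 + α))) ≤ 64 * α * (1 + α) * (1 + β) ^ 3 / β ^ 3 := by
    calc (1 + 1 / β) / (τ / (32 * α * (1 + α)))
        ≤ (1 + 1 / β) / (β ^ 2 / (2 * (1 + β) ^ 2) / (32 * α * (1 + α))) := by gcongr
      _ = _ := by field_simp; ring
  have hsq : α ^ 2 ≤ α * (1 + α) * (1 + β) ^ 3 / β ^ 3 := by
    rw [le_div_iff₀ (by positivity)]
    have : β ^ 3 ≤ (1 + β) ^ 3 := by gcongr; linarith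
    calc α ^ 2 * β ^ 3 ≤ (α * (1 + α)) * (1 + β) ^ 3 := by
          gcongr
          nlinarith
      _ = _ := by ring
  have hr' : r ≤ 130 * B * (α * (1 + α) * (1 + β) ^ 3 / β ^ 5) * rate R I p ^ 2 := by
    refine hr.trans (mul_le_mul_of_nonneg_right ?_ (sq_nonneg _))
    calc _ ≤ 2 / β ^ 2 * (B * (64 * α * (1 + α) * (1 + β) ^ 3 / β ^ 3
          + α * (1 + α) * (1 + β) ^ 3 / β ^ 3)) := by gcongr
      _ = _ := by field_simp; ring
  have hκ := one_add_div_le_kappa hβ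
  have hlevel : (1 + β) / (2 * β) * (66 * B * (α * (α + 1) ^ 2 / β ^ 3) * rate R I p)
      ≤ kappa β * errLevel (66 * B) α β R I p := by
    refine mul_le_mul_of_nonneg_right hκ (by positivity)
  refine le_trans ?_ hlevel
  refine le_of_sq_le_sq ?_ (by positivity)
  have h5 : α * β * (1 + β) ≤ (1 + α) ^ 3 := by
    calc α * β * (1 + β) ≤ (1 + α) * (1 + α) * (1 + α) := by gcongr <;> linarith
      _ = _ := by ring
  calc r ^ 2 = r * r := sq r
    _ ≤ (130 * B * (α * (1 + α) * (1 + β) ^ 3 / β ^ 5) * rate R I p ^ 2) * (α ^ 2 / β ^ 2) :=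
        mul_le_mul hr' hrat hr0 (by positivity)
    _ = 130 * B * (α ^ 2 * (1 + α) * (1 + β) ^ 2 / β ^ 8) * rate R I p ^ 2
          * (α * β * (1 + β)) := by field_simp
    -- 1089 = 33² is the square of 66 halved by the denominator 2β in the lower bound on `kappa`.
    _ ≤ 1089 * B ^ 2 * (α ^ 2 * (1 + α) * (1 + β) ^ 2 / β ^ 8) * rate R I p ^ 2
          * (1 + α) ^ 3 := by
        gcongr ?_ * _ * _ * ?_
        nlinarith
    _ = _ := by field_simp; ring

variable {N : ℕ} {d : Fin N → ℕ}

lemma ztLogLik_nonzeros_eq_sum (S : Finset (MultiIndex d)) (T : Tensor d)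
    (x : MultiIndex d → ℕ) :
    ztLogLik (nonzeros S x) T x = ∑ i ∈ S, ztTerm (x i) (T i) := by
  simp only [ztLogLik, nonzeros, Finset.sum_filter, ztTerm]
  refine Finset.sum_congr rfl fun i _ => ?_
  split_ifs <;> simp_all

lemma card_multiIndex_le : Fintype.card (MultiIndex d) ≤ maxDim d ^ N := by
  rw [Fintype.card_pi]
  calc ∏ n, Fintype.card (Fin (d n)) ≤ ∏ _n : Fin N, maxDim d :=
        Finset.prod_le_prod' fun n _ => by
          rw [Fintype.card_fin]
          exact Finset.le_sup (f := d) (Finset.mem_univ n)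
    _ = _ := by simp

lemma sum_dim_le : ∑ n, d n ≤ N * maxDim d := by
  calc ∑ n, d n ≤ ∑ _n : Fin N, maxDim d :=
        Finset.sum_le_sum fun n _ => Finset.le_sup (f := d) (Finset.mem_univ n)
    _ = _ := by simp

lemma relErr_nonneg (M T : Tensor d) : 0 ≤ relErr M T :=
  div_nonneg (Finset.sum_nonneg fun _ _ => sq_nonneg _) (Finset.sum_nonneg fun _ _ => sq_nonneg _)

lemma one_le_rank_of_mem (hN : 1 ≤ N) [Nonempty (MultiIndex d)] {R : ℕ} {α β : ℝ} (hβ : 0 < β)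
    {M : Tensor d} (hM : M ∈ searchSpace d R β α) : 1 ≤ R := by
  by_contra h
  obtain rfl : R = 0 := by omega
  obtain ⟨a, -, ha⟩ := hasNNCP_of_nnRank_le hN hM.2
  obtain ⟨i⟩ := ‹Nonempty (MultiIndex d)›
  have h1 := (hM.1 i).1
  rw [ha] at h1
  simp at h1
  linarith

end Levels

end ZTPoisson

/-! ### The main theorem, split by the size of I and of the rate. -/

theorem theorem1 (N : ℕ) (hN : 1 ≤ N) :
    ∃ C : ℝ, 0 < C ∧
      ∀ (d : Fin N → ℕ),
        (∀ n, ((N : ℝ) - 1) * Real.logb 2 (ZTPoisson.maxDim d) ^ 2 + 1 ≤ (d n : ℝ)) →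
      ∀ (α β : ℝ), 0 < β → β ≤ α →
      ∀ (R : ℕ) (M : ZTPoisson.Tensor d), M ∈ ZTPoisson.searchSpace d R β α →
      ∀ (p : ℕ), 1 ≤ p →
      ∀ (W : Type*) [MeasurableSpace W] (μ : Measure W) [IsProbabilityMeasure μ]
        (Ω : W → Finset (ZTPoisson.MultiIndex d)) (X : W → ZTPoisson.MultiIndex d → ℕ),
        ZTPoisson.IsPoissonSample μ M p Ω X →
        (1 - (p : ℝ)⁻¹ ≤ μ.real {w | ∀ T ∈ ZTPoisson.searchSpace d R β α,
            ZTPoisson.logLik (Ω w) M (X w) ≤ ZTPoisson.logLik (Ω w) T (X w) →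
            ZTPoisson.relErr M T ≤ ZTPoisson.errLevel C α β R (ZTPoisson.maxDim d) p}) ∧
        (1 - (p : ℝ)⁻¹ ≤ μ.real {w | ∀ T ∈ ZTPoisson.searchSpace d R β α,
            ZTPoisson.ztLogLik (ZTPoisson.nonzeros (Ω w) (X w)) M (X w) ≤
              ZTPoisson.ztLogLik (ZTPoisson.nonzeros (Ω w) (X w)) T (X w) →
            ZTPoisson.relErr M T ≤
              ZTPoisson.kappa β * ZTPoisson.errLevel C α β R (ZTPoisson.maxDim d) p}) := by
  have hB := ZTPoisson.one_le_entropyConst N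
  refine ⟨66 * ZTPoisson.entropyConst N, by positivity, ?_⟩
  intro d hdim α β hβ hβα R M hM p hp W _ μ _ Ω X h
  have hα : 0 < α := hβ.trans_le hβα
  have hd : ∀ n, 1 ≤ d n := fun n => by
    have h1 : (1 : ℝ) ≤ N := by exact_mod_cast hN
    have h2 : 0 ≤ ((N : ℝ) - 1) * Real.logb 2 (ZTPoisson.maxDim d) ^ 2 :=
      mul_nonneg (by linarith) (sq_nonneg _)
    exact_mod_cast (by linarith [hdim n] : (1 : ℝ) ≤ d n)
  have hne : Nonempty (ZTPoisson.MultiIndex d) := ⟨fun n => ⟨0, hd n⟩⟩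
  have hR := ZTPoisson.one_le_rank_of_mem hN hβ hM
  have hpI : p ≤ ZTPoisson.maxDim d ^ N := h.le_card.trans ZTPoisson.card_multiIndex_le
  -- With I ≤ 1 there is a single entry, so p = 1 and the required probability is 0.
  rcases Nat.lt_or_ge (ZTPoisson.maxDim d) 2 with hI | hI
  · have hp1 : p = 1 := by
      have : ZTPoisson.maxDim d ^ N ≤ 1 := pow_le_one₀ (Nat.zero_le _) (by omega)
      omega
    subst hp1
    simp
  have hl := ZTPoisson.one_le_logb_two hI
  have h0 : 0 ≤ ZTPoisson.rate R (ZTPoisson.maxDim d) p := by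
    unfold ZTPoisson.rate
    positivity
  have hκ : 0 < ZTPoisson.kappa β :=
    lt_of_lt_of_le (by positivity) (ZTPoisson.one_add_div_le_kappa hβ)
  rcases le_or_gt 1 (ZTPoisson.rate R (ZTPoisson.maxDim d) p) with hrate | hrate
  · have hp0 : (0 : ℝ) ≤ (p : ℝ)⁻¹ := by positivity
    constructor
    · rw [Set.eq_univ_of_forall (s := {w | ∀ T ∈ ZTPoisson.searchSpace d R β α, _ → _})
        fun w T hT _ => (ZTPoisson.relErr_le_ratio_sq hβ hM hT).trans
          (ZTPoisson.ratio_sq_le_errLevel (by linarith) hβ hβα hrate), probReal_univ]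
      linarith
    · rw [Set.eq_univ_of_forall (s := {w | ∀ T ∈ ZTPoisson.searchSpace d R β α, _ → _})
        fun w T hT _ => ?_, probReal_univ]
      · linarith
      -- `kappa β` is only known to be at least 1/2 here, so the trivial bound is fitted under half
      -- the constant.
      · have h1 := (ZTPoisson.relErr_le_ratio_sq hβ hM hT).trans
          (ZTPoisson.ratio_sq_le_errLevel (C := 33 * ZTPoisson.entropyConst N) (by linarith)
            hβ hβα hrate)
        refine h1.trans ?_
        have h2 : ZTPoisson.errLevel (33 * ZTPoisson.entropyConst N) α β R
            (ZTPoisson.maxDim d) p = 1 / 2 * ZTPoisson.errLevel (66 * ZTPoisson.entropyConst N)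
              α β R (ZTPoisson.maxDim d) p := by
          unfold ZTPoisson.errLevel
          ring
        rw [h2]
        refine mul_le_mul_of_nonneg_right ?_ ?_
        · refine le_trans ?_ (ZTPoisson.one_add_div_le_kappa hβ)
          rw [div_le_div_iff₀ (by norm_num) (by positivity)]
          linarith
        · unfold ZTPoisson.errLevel
          positivity
  · constructor
    · refine (ZTPoisson.one_sub_inv_le_measureReal_relErr_le hN hd hβ hβα hR hM hp h
        (φ := ZTPoisson.poissonTerm) (γ := 1 / (32 * α * (1 + α))) (Λ := 1) (by positivity)
        ?_ zero_le_one (fun k t u ht hu => ZTPoisson.poissonTerm_le (hβ.trans_le ht) hu)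
        fun m t hm ht hmα htα => ZTPoisson.lintegral_exp_poissonTerm_le (hβ.trans_le hm)
          (hβ.trans_le ht) hmα htα).trans (measureReal_mono fun w hw T hT hle => ?_)
      · rw [div_mul_eq_mul_div, div_le_one (by positivity)]
        nlinarith
      · exact ZTPoisson.le_errLevel_of_le_rate_sq hB hβ hβα h0 hrate ((hw T hT hle).trans
          (ZTPoisson.deviation_le_rate_sq hR hI hp hpI hrate ZTPoisson.sum_dim_le hβ
            (by positivity) le_rfl))
    · have hτ : 0 < (Real.exp β - 1 - β) * Real.exp (-β) :=
        lt_of_lt_of_le (by positivity) (ZTPoisson.sq_div_le_exp_sub_mul_exp_neg hβ)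
      have hτ1 : (Real.exp β - 1 - β) * Real.exp (-β) ≤ 1 := by
        have h3 : Real.exp β * Real.exp (-β) = 1 := by rw [← Real.exp_add]; simp
        nlinarith [Real.exp_pos (-β), mul_pos hβ (Real.exp_pos (-β))]
      have hΛ : 1 ≤ 1 + 1 / β := by
        have : 0 < 1 / β := by positivity
        linarith
      refine (ZTPoisson.one_sub_inv_le_measureReal_relErr_le hN hd hβ hβα hR hM hp h
        (φ := ZTPoisson.ztTerm)
        (γ := (Real.exp β - 1 - β) * Real.exp (-β) / (32 * α * (1 + α)))
        (Λ := 1 + 1 / β) (by positivity)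
        ?_ (by linarith) (fun k t u ht hu => ZTPoisson.ztTerm_le hβ ht hu)
        fun m t hm ht hmα htα => ZTPoisson.lintegral_exp_ztTerm_le hβ hm ht hmα htα).trans
          (measureReal_mono fun w hw T hT hle => ?_)
      · rw [div_mul_eq_mul_div, div_le_one (by positivity)]
        calc _ ≤ 1 * (4 * α ^ 2) := by gcongr
          _ ≤ _ := by nlinarith
      · rw [ZTPoisson.ztLogLik_nonzeros_eq_sum, ZTPoisson.ztLogLik_nonzeros_eq_sum] at hle
        exact ZTPoisson.le_kappa_mul_errLevel_of_le_rate_sq hB hβ hβα h0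
          (ZTPoisson.relErr_nonneg M T) (ZTPoisson.relErr_le_ratio_sq hβ hM hT)
          ((hw T hT hle).trans (ZTPoisson.deviation_le_rate_sq hR hI hp hpI hrate
            ZTPoisson.sum_dim_le hβ (by positivity) hΛ))
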